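/- Conventions: all manifolds are smooth, finite-dimensional, Hausdorff, second countable and without boundary; $\mathbb T^k=(S^1)^k=\mathbb R^k/\mathbb Z^k$; $d\eta(X,Y)=X\eta(Y)-Y\eta(X)-\eta([X,Y])$. Definitions. A metric $f\cdot$pk-structure $(\varphi,\xi_i,\eta^i,g)$ on $M$ ($1\le i\le k$) consists of a smooth endomorphism field $\varphi$ of $TM$, smooth vector fields $\xi_i$, smooth 1-forms $\eta^i$ and a Riemannian metric $g$ such that $\varphi^3+\varphi=0$, $\eta^i(\xi_j)=\delta^i_j$, $\varphi(\xi_i)=0$, $\eta^i\circ\varphi=0$, $\varphi^2=-\mathrm{Id}+\sum_i\eta^i\otimes\xi_i$ and $g(X,Y)=g(\varphi X,\varphi Y)+\sum_i\eta^i(X)\eta^i(Y)$. Its fundamental 2-form is $\Phi_g(X,Y)=g(\varphi X,Y)$. It is an almost $\mathcal S$-structure if $d\Phi_g=0$ and there are real constants $\alpha^i$ with $d\eta^i=-\alpha^i\Phi_g$ for all $i$. An almost complex structure $J$ on a symplectic manifold $(N,\omega)$ is compatible if $\omega(JX,JY)=\omega(X,Y)$ and $G(X,Y)=\omega(X,JY)$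 is a Riemannian metric. A connection 1-form on a principal $\mathbb T^k$-bundle is a $\mathbb T^k$-invariant smooth $\mathbb R^k$-valued 1-form $\boldsymbol\eta=(\eta^1,\dots,\eta^k)$ with $\boldsymbol\eta(X_M)=X$ for $X\in\mathbb R^k$, where $X_M$ is the vector field generated by $X$; the horizontal lift $\tilde\pi v$ of $v\in T_{\pi(x)}N$ to $x$ is the vector $w \in T_xM$ with $\pi_*w=v$ and $\boldsymbol\eta(w)=0$. Theorem. Let $k\ge 0$, let $\pi:M\to N$ be a principal $\mathbb T^k$-bundle over a symplectic manifold $(N,\omega)$, and let $\boldsymbol\eta=(\eta^1,\dots,\eta^k)$ be a connection 1-form on $M$ such that $d\eta^i=-\alpha^i\pi^*\omega$ for real constants $\alpha^1,\dots,\alpha^k$. Then $M$ admits an almost $\mathcal S$-structure. More precisely, $(N,\omega)$ has a compatible almost complex structure, and for every compatible almost complex structure $J$, with associated metric $G$, there is an almost $\mathcal S$-structure $(\varphi,\xi_i,\eta^i,g)$ on $M$ whose 1-forms $\eta^i$ are the components of $\boldsymbol\eta$, whose vector fields $\xi_i$ are vertical, and for which $$\varphi X=\tilde\pi J\pi_*X,\qquad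 g=\pi^*G+\sum_{i=1}^k\eta^i\otimes\eta^i .$$ Moreover $\Phi_g=\pi^*\omega$, and hence $d\eta^i=-\alpha^i\Phi_g$ for all $i$. -/

import Mathlib

open Set Bundle
open scoped Manifold ContDiff

noncomputable section

/-! ### Differential forms on a manifold -/

section Forms

variable {E : Type*} [NormedAddCommGroup E] [NormedSpace ℝ E]
  {H : Type*} [TopologicalSpace H] (I : ModelWithCorners ℝ E H)
  (M : Type*) [TopologicalSpace M] [ChartedSpace H M]

/-- A (not necessarily smooth) real differential `n`-form on `M`: an alternating `n`-linear form on
each tangent space. -/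
abbrev DForm (n : ℕ) : Type _ := ∀ x : M, (TangentSpace I x) [⋀^Fin n]→L[ℝ] ℝ

variable {I M}

namespace DForm

/-- The expression of a form in the preferred chart `ψ` at `x₀`, that is `(ψ⁻¹)^* Ω`, as a form on
the model vector space `E`. It is meaningful on the target of the chart. -/
def inChart {n : ℕ} (Ω : DForm I M n) (x₀ : M) : E → E [⋀^Fin n]→L[ℝ] ℝ := fun y =>
  (Ω ((extChartAt I x₀).symm y)).compContinuousLinearMap
    (mfderiv 𝓘(ℝ, E) I (extChartAt I x₀).symm y : E →L[ℝ] _)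

/-- A form is smooth if its expression in every preferred chart is `C^∞`. -/
def IsSmooth {n : ℕ} (Ω : DForm I M n) : Prop :=
  ∀ x₀ : M, ContDiffOn ℝ ∞ (Ω.inChart x₀) (extChartAt I x₀).target

/-- The exterior derivative: at `x` it is `ψ^* d ((ψ⁻¹)^* Ω)`, where `ψ` is the preferred chart
at `x`. For a smooth form on a boundaryless manifold the result does not depend on the chart, `d`
being natural. The normalization is `dη(X, Y) = X η(Y) - Y η(X) - η([X, Y])`. -/
def d {n : ℕ} (Ω : DForm I M n) : DForm I M (n + 1) := fun x =>
  (extDeriv (Ω.inChart x) (extChartAt I x x)).compContinuousLinearMap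
    (mfderiv I 𝓘(ℝ, E) (extChartAt I x) x : TangentSpace I x →L[ℝ] E)

end DForm

/-- The pullback `f^* Ω` of a form by a map `f : M → N`. -/
def DForm.pullback {E' : Type*} [NormedAddCommGroup E'] [NormedSpace ℝ E']
    {H' : Type*} [TopologicalSpace H'] {I' : ModelWithCorners ℝ E' H'}
    {N : Type*} [TopologicalSpace N] [ChartedSpace H' N] {n : ℕ}
    (f : M → N) (Ω : DForm I' N n) : DForm I M n := fun x =>
  (Ω (f x)).compContinuousLinearMap (mfderiv I I' f x)

/-- `Ω` is a symplectic form: a smooth, closed, nondegenerate 2-form. -/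
structure IsSymplecticForm (Ω : DForm I M 2) : Prop where
  smooth : Ω.IsSmooth
  closed : Ω.d = 0
  nondegenerate : ∀ (x : M) (u : TangentSpace I x),
    (∀ v : TangentSpace I x, Ω x ![u, v] = 0) → u = 0

variable [IsManifold I ∞ M]

/-- Smoothness of an endomorphism field, as a section of the bundle `End(TM)`. -/
def IsSmoothEndo (A : ∀ x : M, TangentSpace I x →L[ℝ] TangentSpace I x) : Prop :=
  ContMDiff I (I.prod 𝓘(ℝ, E →L[ℝ] E)) ∞
    (fun x => TotalSpace.mk' (E →L[ℝ] E)
      (E := fun x : M => TangentSpace I x →L[ℝ] TangentSpace I x) x (A x))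

/-- Smoothness of a vector field, as a section of the tangent bundle. -/
def IsSmoothVectorField (X : ∀ x : M, TangentSpace I x) : Prop :=
  ContMDiff I I.tangent ∞ (fun x => (⟨x, X x⟩ : TangentBundle I M))

/-- `J` is an almost complex structure compatible with the 2-form `Ω`: `J² = -1`,
`Ω(JX, JY) = Ω(X, Y)` and `Ω(X, JX) > 0` for `X ≠ 0`. The associated Riemannian metric is
`G(X, Y) = Ω(X, JY)`. -/
structure IsCompatibleAlmostComplex (Ω : DForm I M 2)
    (J : ∀ x : M, TangentSpace I x →L[ℝ] TangentSpace I x) : Prop where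
  smooth : IsSmoothEndo J
  sq : ∀ (x : M) (u : TangentSpace I x), J x (J x u) = -u
  invariant : ∀ (x : M) (u v : TangentSpace I x), Ω x ![J x u, J x v] = Ω x ![u, v]
  pos : ∀ (x : M) (u : TangentSpace I x), u ≠ 0 → 0 < Ω x ![u, J x u]

end Forms

/-! ### Almost S-structures -/

section AlmostS

variable {E : Type*} [NormedAddCommGroup E] [NormedSpace ℝ E]
  {H : Type*} [TopologicalSpace H] (I : ModelWithCorners ℝ E H)
  (M : Type*) [TopologicalSpace M] [ChartedSpace H M] [IsManifold I ∞ M]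

/-- A metric `f·pk`-structure `(φ, ξ_i, η^i, g)` on `M`: an `f`-structure whose kernel is
trivialized by the frame `ξ_1, …, ξ_k` with coframe `η^1, …, η^k`, and a compatible Riemannian
metric. -/
structure MetricFPKStructure (k : ℕ) where
  /-- the `f`-structure -/
  φ : ∀ x : M, TangentSpace I x →L[ℝ] TangentSpace I x
  /-- the frame of the kernel -/
  ξ : Fin k → ∀ x : M, TangentSpace I x
  /-- the coframe -/
  η : Fin k → DForm I M 1
  /-- the Riemannian metric -/
  g : ContMDiffRiemannianMetric I ∞ E (fun x : M => TangentSpace I x)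
  smooth_φ : IsSmoothEndo φ
  smooth_ξ : ∀ i, IsSmoothVectorField (ξ i)
  smooth_η : ∀ i, (η i).IsSmooth
  f_structure : ∀ (x : M) (u : TangentSpace I x), φ x (φ x (φ x u)) + φ x u = 0
  η_ξ : ∀ (i j : Fin k) (x : M), η i x ![ξ j x] = if i = j then 1 else 0
  φ_ξ : ∀ (i : Fin k) (x : M), φ x (ξ i x) = 0
  η_φ : ∀ (i : Fin k) (x : M) (u : TangentSpace I x), η i x ![φ x u] = 0
  φ_sq : ∀ (x : M) (u : TangentSpace I x), φ x (φ x u) = -u + ∑ i, η i x ![u] • ξ i x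
  compatible : ∀ (x : M) (u v : TangentSpace I x),
    g.inner x u v = g.inner x (φ x u) (φ x v) + ∑ i, η i x ![u] * η i x ![v]

variable {I M}

namespace MetricFPKStructure

variable {k : ℕ} (S : MetricFPKStructure I M k)

theorem inner_φ_self (x : M) (u : TangentSpace I x) : S.g.inner x (S.φ x u) u = 0 := by
  have h1 : ∀ i, S.g.inner x (S.ξ i x) (S.φ x u) = 0 := fun i => by
    rw [S.compatible]; simp [S.φ_ξ, S.η_φ]
  have h2 := S.compatible x (S.φ x u) u
  rw [S.φ_sq] at h2
  simp only [S.η_φ, zero_mul, Finset.sum_const_zero, add_zero, map_add, map_neg, map_sum, map_smul,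
    add_apply, neg_apply, sum_apply, smul_apply, h1,
    smul_zero] at h2
  rw [S.g.symm x u] at h2
  linarith

/-- The fundamental 2-form `Φ_g(X, Y) = g(φX, Y)`. -/
def fundamentalForm : DForm I M 2 := fun x =>
  { toFun := fun w => S.g.inner x (S.φ x (w 0)) (w 1)
    map_update_add' := fun w i a b => by
      fin_cases i <;> simp
    map_update_smul' := fun w i c a => by
      fin_cases i <;> simp
    cont := by
      have h : Continuous fun p : E × E =>
          (show E →L[ℝ] E →L[ℝ] ℝ from S.g.inner x) ((show E →L[ℝ] E from S.φ x) p.1) p.2 := by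
        fun_prop
      exact h.comp ((continuous_apply (0 : Fin 2)).prodMk (continuous_apply (1 : Fin 2)) :
        Continuous fun w : Fin 2 → E => (w 0, w 1))
    map_eq_zero_of_eq' := fun w i j hij hne => by
      fin_cases i <;> fin_cases j <;> simp at hij hne
      · rw [hij]; exact S.inner_φ_self x (w 1)
      · rw [← hij]; exact S.inner_φ_self x (w 1) }

/-- An almost K-structure: a metric `f·pk`-structure with `dΦ_g = 0`. -/
def IsAlmostK : Prop := S.fundamentalForm.d = 0

/-- An almost S-structure: an almost K-structure such that `dη^i = -α^i Φ_g` for real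
constants `α^1, …, α^k`. -/
def IsAlmostS : Prop :=
  S.IsAlmostK ∧ ∃ α : Fin k → ℝ, ∀ i, (S.η i).d = -(α i) • S.fundamentalForm

end MetricFPKStructure

end AlmostS

/-! ### Principal torus bundles and connections -/

section Principal

/-- The torus `𝕋^k = (S^1)^k`, a group and a manifold with the product structures. -/
abbrev Torus (k : ℕ) : Type := Fin k → Circle

/-- The model with corners of the torus. -/
abbrev torusModel (k : ℕ) : ModelWithCorners ℝ (Fin k → EuclideanSpace ℝ (Fin 1))
    (ModelPi fun _ : Fin k => EuclideanSpace ℝ (Fin 1)) :=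
  ModelWithCorners.pi fun _ : Fin k => 𝓡 1

/-- The exponential map `ℝ^k → 𝕋^k = ℝ^k / ℤ^k` of the torus. -/
def torusExp {k : ℕ} (t : Fin k → ℝ) : Torus k := fun i => Circle.exp (2 * Real.pi * t i)

variable {E : Type*} [NormedAddCommGroup E] [NormedSpace ℝ E]
  {H : Type*} [TopologicalSpace H] (I : ModelWithCorners ℝ E H)
  {M : Type*} [TopologicalSpace M] [ChartedSpace H M]
  {E' : Type*} [NormedAddCommGroup E'] [NormedSpace ℝ E']
  {H' : Type*} [TopologicalSpace H'] (I' : ModelWithCorners ℝ E' H')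
  {N : Type*} [TopologicalSpace N] [ChartedSpace H' N]
  (k : ℕ) [MulAction (Torus k) M]

/-- `proj : M → N` is a smooth principal `𝕋^k`-bundle: the action on `M` is smooth, and `N` is covered
by open sets `U` with a smooth equivariant trivialization `proj⁻¹(U) ≃ U × 𝕋^k` over `U`. (In
particular the action is free and its orbits are the fibres of `proj`.) -/
structure IsPrincipalTorusBundle (proj : M → N) : Prop where
  smooth_proj : ContMDiff I I' ∞ proj
  smooth_action : ContMDiffSMul (torusModel k) I ∞ (Torus k) M
  locally_trivial : ∀ b : N, ∃ e : Trivialization (Torus k) proj, b ∈ e.baseSet ∧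
    ContMDiffOn I (I'.prod (torusModel k)) ∞ e e.source ∧
    ContMDiffOn (I'.prod (torusModel k)) I ∞ e.toOpenPartialHomeomorph.symm e.target ∧
    ∀ (t : Torus k), ∀ x ∈ e.source, t • x ∈ e.source ∧ e (t • x) = (proj x, t * (e x).2)

variable {k}

/-- The vector field `X_M` on `M` generated by `X ∈ ℝ^k = Lie(𝕋^k)`:
`X_M(x) = d/ds|_{s = 0} exp(sX) · x`. -/
def infinitesimalAction (X : Fin k → ℝ) (x : M) : TangentSpace I x :=
  (mfderiv 𝓘(ℝ, ℝ) I (fun s : ℝ => torusExp (s • X) • x) 0 : ℝ →L[ℝ] E) 1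

/-- `η = (η^1, …, η^k)` is a connection 1-form: a smooth `ℝ^k`-valued 1-form, invariant under the
torus, with `η(X_M) = X` for every `X ∈ ℝ^k`. -/
structure IsConnectionForm (η : Fin k → DForm I M 1) : Prop where
  smooth : ∀ i, (η i).IsSmooth
  invariant : ∀ (t : Torus k) (i : Fin k), (η i).pullback (fun x : M => t • x) = η i
  vertical : ∀ (X : Fin k → ℝ) (i : Fin k) (x : M), η i x ![infinitesimalAction I X x] = X i

variable {I I'}

/-- `w ∈ T_x M` is the horizontal lift of `v ∈ T_{proj x} N` with respect to `η`. -/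
def IsHorizontalLift (proj : M → N) (η : Fin k → DForm I M 1) (x : M)
    (v : TangentSpace I' (proj x)) (w : TangentSpace I x) : Prop :=
  mfderiv I I' proj x w = v ∧ ∀ i, η i x ![w] = 0

end Principal

end

open scoped Topology

noncomputable section

section Frames

variable {E : Type*} [NormedAddCommGroup E] [NormedSpace ℝ E]
  {H : Type*} [TopologicalSpace H] {I : ModelWithCorners ℝ E H}
  {M : Type*} [TopologicalSpace M] [ChartedSpace H M]

/-- In finite dimension, smoothness of a family of linear maps can be checked pointwise. -/
theorem contMDiffAt_clm_of_apply {F G : Type*} [NormedAddCommGroup F] [NormedSpace ℝ F]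
    [FiniteDimensional ℝ F] [NormedAddCommGroup G] [NormedSpace ℝ G] {n : WithTop ℕ∞}
    {f : M → F →L[ℝ] G} {x₀ : M}
    (h : ∀ u, ContMDiffAt I 𝓘(ℝ, G) n (fun x => f x u) x₀) :
    ContMDiffAt I 𝓘(ℝ, F →L[ℝ] G) n f x₀ := by
  let d := Module.finrank ℝ F
  have hd : d = Module.finrank ℝ (Fin d → ℝ) := (Module.finrank_fin_fun ℝ).symm
  let e₁ := ContinuousLinearEquiv.ofFinrankEq hd
  let e₂ := (e₁.arrowCongr (1 : G ≃L[ℝ] G)).trans (ContinuousLinearEquiv.piRing (Fin d))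
  have h2 : ContMDiffAt I 𝓘(ℝ, Fin d → G) n (fun x => e₂ (f x)) x₀ := by
    rw [contMDiffAt_pi_space]
    exact fun i => h _
  have h3 := e₂.symm.contDiff.contMDiff.contMDiffAt.comp x₀ h2
  refine h3.congr_of_eventuallyEq (Filter.Eventually.of_forall fun x => ?_)
  simp

variable [IsManifold I ∞ M]

/-- The frame of the tangent bundle given by the chart at `x₀`. -/
def chartFrame (x₀ x : M) : E →L[ℝ] TangentSpace I x :=
  (trivializationAt E (TangentSpace I) x₀).symmL ℝ x

/-- The coordinates of tangent vectors in the frame given by the chart at `x₀`. -/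
def chartCoframe (x₀ x : M) : TangentSpace I x →L[ℝ] E :=
  (trivializationAt E (TangentSpace I) x₀).continuousLinearMapAt ℝ x

theorem chartCoframe_chartFrame {x₀ x : M} (hx : x ∈ (chartAt H x₀).source) (v : E) :
    chartCoframe (I := I) x₀ x (chartFrame (I := I) x₀ x v) = v :=
  Trivialization.continuousLinearMapAt_symmL _ hx v

theorem chartFrame_chartCoframe {x₀ x : M} (hx : x ∈ (chartAt H x₀).source)
    (u : TangentSpace I x) : chartFrame x₀ x (chartCoframe x₀ x u) = u :=
  Trivialization.symmL_continuousLinearMapAt _ hx u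

theorem eventually_mem_chart_source (x₀ : M) : ∀ᶠ x in 𝓝 x₀, x ∈ (chartAt H x₀).source :=
  chart_source_mem_nhds H x₀

theorem isSmoothVectorField_iff_chartCoframe {X : ∀ x : M, TangentSpace I x} :
    IsSmoothVectorField X ↔
      ∀ x₀, ContMDiffAt I 𝓘(ℝ, E) ∞ (fun x => chartCoframe x₀ x (X x)) x₀ := by
  refine forall_congr' fun x₀ => ?_
  rw [Bundle.contMDiffAt_section]
  refine Filter.EventuallyEq.contMDiffAt_iff ?_
  filter_upwards [eventually_mem_chart_source (H := H) x₀] with x hx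
  exact (Trivialization.coe_linearMapAt_of_mem (R := ℝ)
    (trivializationAt E (TangentSpace I) x₀) hx ▸ rfl)

theorem isSmoothEndo_iff_chartFrame {A : ∀ x : M, TangentSpace I x →L[ℝ] TangentSpace I x} :
    IsSmoothEndo A ↔ ∀ x₀, ContMDiffAt I 𝓘(ℝ, E →L[ℝ] E) ∞
      (fun x => (chartCoframe x₀ x).comp ((A x).comp (chartFrame x₀ x))) x₀ := by
  refine forall_congr' fun x₀ => ?_
  rw [contMDiffAt_hom_bundle]
  exact ⟨fun h => h.2, fun h => ⟨contMDiffAt_id, h⟩⟩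

/-- A bilinear form field on `M` is smooth if it is smooth in the frames given by the charts. -/
theorem contMDiffAt_bilin_iff_chartFrame [FiniteDimensional ℝ E]
    {g : ∀ x : M, TangentSpace I x →L[ℝ] TangentSpace I x →L[ℝ] ℝ} {x₀ : M} :
    ContMDiffAt I (I.prod 𝓘(ℝ, E →L[ℝ] E →L[ℝ] ℝ)) ∞
      (fun b ↦ TotalSpace.mk' (E →L[ℝ] E →L[ℝ] ℝ)
        (E := fun x : M => TangentSpace I x →L[ℝ] TangentSpace I x →L[ℝ] ℝ) b (g b)) x₀ ↔
      ∀ u v, ContMDiffAt I 𝓘(ℝ, ℝ) ∞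
        (fun x => g x (chartFrame x₀ x u) (chartFrame x₀ x v)) x₀ := by
  rw [contMDiffAt_hom_bundle]
  have key : ∀ u v, (fun x => ContinuousLinearMap.inCoordinates E (TangentSpace I) (E →L[ℝ] ℝ)
      (fun x : M => TangentSpace I x →L[ℝ] ℝ) x₀ x x₀ x (g x) u v) =ᶠ[𝓝 x₀]
      (fun x => g x (chartFrame x₀ x u) (chartFrame x₀ x v)) := by
    intro u v
    filter_upwards [eventually_mem_chart_source (H := H) x₀] with x hx
    erw [inCoordinates_apply_eq₂ hx hx (mem_univ _), Bundle.Trivial.linearMapAt_trivialization]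
    rw [chartFrame, Trivialization.symmL_apply _ hx, Trivialization.symmL_apply _ hx]
    rfl
  constructor
  · rintro ⟨-, h⟩ u v
    exact ((h.clm_apply contMDiffAt_const).clm_apply contMDiffAt_const).congr_of_eventuallyEq
      (key u v).symm
  · intro h
    refine ⟨contMDiffAt_id, contMDiffAt_clm_of_apply fun u => contMDiffAt_clm_of_apply fun v => ?_⟩
    exact (h u v).congr_of_eventuallyEq (key u v)

theorem DForm.IsSmooth.contMDiffAt_chartFrame [I.Boundaryless] {n : ℕ} {Ω : DForm I M n}
    (hΩ : Ω.IsSmooth) (x₀ : M) (w : Fin n → E) :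
    ContMDiffAt I 𝓘(ℝ, ℝ) ∞ (fun x => Ω x (fun i => chartFrame x₀ x (w i))) x₀ := by
  have h1 : ContDiffAt ℝ ∞ (fun y => Ω.inChart x₀ y w) (extChartAt I x₀ x₀) := by
    have h2 := (hΩ x₀).contDiffAt (extChartAt_target_mem_nhds (I := I) x₀)
    exact (ContinuousAlternatingMap.apply ℝ E ℝ w).contDiff.contDiffAt.comp _ h2
  have h2 := h1.contMDiffAt.comp x₀ (contMDiffAt_extChartAt (I := I) (n := ∞))
  refine h2.congr_of_eventuallyEq ?_
  filter_upwards [eventually_mem_chart_source (H := H) x₀] with x hx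
  have hx' : x ∈ (extChartAt I x₀).source := by rwa [extChartAt_source]
  simp only [Function.comp_def, DForm.inChart]
  have key : ∀ z (_ : z = x) (A : E →L[ℝ] E),
      Ω x (fun i => (show TangentSpace I x from A (w i))) =
        Ω z (fun i => (show TangentSpace I z from A (w i))) := by
    rintro _ rfl A
    rfl
  have h3 := TangentBundle.symmL_trivializationAt (I := I) (𝕜 := ℝ) hx
  rw [I.range_eq_univ, mfderivWithin_univ] at h3
  unfold chartFrame
  rw [h3]
  exact key _ ((extChartAt I x₀).left_inv hx')
    (mfderiv 𝓘(ℝ, E) I (extChartAt I x₀).symm (extChartAt I x₀ x))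

theorem contMDiffAt_mfderiv_chartFrame
    {E' : Type*} [NormedAddCommGroup E'] [NormedSpace ℝ E']
    {H' : Type*} [TopologicalSpace H'] {I' : ModelWithCorners ℝ E' H'}
    {N : Type*} [TopologicalSpace N] [ChartedSpace H' N] [IsManifold I' ∞ N]
    {f : M → N} (hf : ContMDiff I I' ∞ f) (x₀ : M) :
    ContMDiffAt I 𝓘(ℝ, E →L[ℝ] E') ∞ (fun x =>
      (chartCoframe (f x₀) (f x)).comp ((mfderiv I I' f x).comp (chartFrame x₀ x))) x₀ :=
  (hf x₀).mfderiv_const (m := ∞) le_rfl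

end Frames

section Pullback

variable {E : Type*} [NormedAddCommGroup E] [NormedSpace ℝ E]
  {H : Type*} [TopologicalSpace H] {I : ModelWithCorners ℝ E H} [I.Boundaryless]
  {M : Type*} [TopologicalSpace M] [ChartedSpace H M] [IsManifold I ∞ M]
  {E' : Type*} [NormedAddCommGroup E'] [NormedSpace ℝ E']
  {H' : Type*} [TopologicalSpace H'] {I' : ModelWithCorners ℝ E' H'} [I'.Boundaryless]
  {N : Type*} [TopologicalSpace N] [ChartedSpace H' N] [IsManifold I' ∞ N]

theorem DForm.pullback_inChart_eventuallyEq {n : ℕ} (Ω : DForm I' N n) {f : M → N}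
    (hf : ContMDiff I I' ∞ f) (x : M) :
    (Ω.pullback f : DForm I M n).inChart x =ᶠ[𝓝 (extChartAt I x x)]
      fun y => (Ω.inChart (f x)
        ((extChartAt I' (f x) ∘ f ∘ (extChartAt I x).symm) y)).compContinuousLinearMap
          (fderiv ℝ (extChartAt I' (f x) ∘ f ∘ (extChartAt I x).symm) y) := by
  set ψ := extChartAt I x with hψ
  set χ := extChartAt I' (f x) with hχ
  have hsymm : ∀ y ∈ ψ.target, ContMDiffAt 𝓘(ℝ, E) I ∞ ψ.symm y := fun y hy =>
    (contMDiffOn_extChartAt_symm x).contMDiffAt ((isOpen_extChartAt_target x).mem_nhds hy)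
  have hopen : IsOpen (ψ.target ∩ (f ∘ ψ.symm) ⁻¹' χ.source) :=
    ((hf.continuous.comp_continuousOn (continuousOn_extChartAt_symm x)).isOpen_inter_preimage
      (isOpen_extChartAt_target x) (isOpen_extChartAt_source (f x)))
  have hmem : ψ x ∈ ψ.target ∩ (f ∘ ψ.symm) ⁻¹' χ.source := by
    refine ⟨mem_extChartAt_target x, ?_⟩
    simp [hψ, hχ]
  filter_upwards [hopen.mem_nhds hmem] with y hy
  have hfd : MDifferentiableAt I I' f (ψ.symm y) := hf.mdifferentiable (by simp) _
  have hψd : MDifferentiableAt 𝓘(ℝ, E) I ψ.symm y :=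
    (hsymm y hy.1).mdifferentiableAt (by simp)
  have hχd : MDifferentiableAt I' 𝓘(ℝ, E') χ (f (ψ.symm y)) :=
    mdifferentiableAt_extChartAt (by simpa [hχ] using hy.2)
  have hFd : MDifferentiableAt 𝓘(ℝ, E) 𝓘(ℝ, E') (χ ∘ f ∘ ψ.symm) y :=
    hχd.comp y (hfd.comp y hψd)
  have hχy : (χ ∘ f ∘ ψ.symm) y ∈ χ.target := χ.map_source hy.2
  have hχs : MDifferentiableAt 𝓘(ℝ, E') I' χ.symm ((χ ∘ f ∘ ψ.symm) y) :=
    ((contMDiffOn_extChartAt_symm (I := I') (n := ∞) (f x)).contMDiffAt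
      ((isOpen_extChartAt_target (f x)).mem_nhds hχy)).mdifferentiableAt (by simp)
  have e1 : χ.symm ∘ (χ ∘ f ∘ ψ.symm) =ᶠ[𝓝 y] f ∘ ψ.symm := by
    filter_upwards [hopen.mem_nhds hy] with z hz
    exact χ.left_inv hz.2
  have e2 := e1.mfderiv_eq (I := 𝓘(ℝ, E)) (I' := I')
  rw [mfderiv_comp y hχs hFd, mfderiv_comp y hfd hψd, mfderiv_eq_fderiv] at e2
  have key : ∀ z (_ : z = f (ψ.symm y)) (A : E →L[ℝ] E') (w : Fin n → E),
      Ω (f (ψ.symm y)) (fun i => (show TangentSpace I' (f (ψ.symm y)) from A (w i))) =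
        Ω z (fun i => (show TangentSpace I' z from A (w i))) := by
    rintro _ rfl A w
    rfl
  ext w
  refine (congrArg (fun A : E →L[ℝ] E' => Ω (f (ψ.symm y))
    (fun i => (show TangentSpace I' (f (ψ.symm y)) from A (w i)))) e2.symm).trans ?_
  exact key _ (χ.left_inv hy.2) _ w

/-- The exterior derivative commutes with pullback. -/
theorem DForm.IsSmooth.d_pullback {n : ℕ} {Ω : DForm I' N n} (hΩ : Ω.IsSmooth) {f : M → N}
    (hf : ContMDiff I I' ∞ f) : (Ω.pullback f : DForm I M n).d = Ω.d.pullback f := by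
  funext x
  have hF : ContMDiffAt 𝓘(ℝ, E) 𝓘(ℝ, E') ∞
      (extChartAt I' (f x) ∘ f ∘ (extChartAt I x).symm) (extChartAt I x x) := by
    have h1 : ContMDiffAt 𝓘(ℝ, E) I ∞ (extChartAt I x).symm (extChartAt I x x) :=
      (contMDiffOn_extChartAt_symm x).contMDiffAt (extChartAt_target_mem_nhds x)
    have h2 : ContMDiffAt 𝓘(ℝ, E) I' ∞ (f ∘ (extChartAt I x).symm) (extChartAt I x x) :=
      (hf _).comp _ h1
    refine ContMDiffAt.comp _ (contMDiffAt_extChartAt' ?_) h2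
    simp
  have hFx : (extChartAt I' (f x) ∘ f ∘ (extChartAt I x).symm) (extChartAt I x x) =
      extChartAt I' (f x) (f x) := by simp
  have hΩd : DifferentiableAt ℝ (Ω.inChart (f x))
      ((extChartAt I' (f x) ∘ f ∘ (extChartAt I x).symm) (extChartAt I x x)) := by
    rw [hFx]
    exact ((hΩ (f x)).contDiffAt (extChartAt_target_mem_nhds (f x))).differentiableAt (by simp)
  have e1 := extDeriv_pullback hΩd hF.contDiffAt
    (by simpa using (WithTop.coe_le_coe.2 le_top : ((2 : ℕ∞) : WithTop ℕ∞) ≤ ∞))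
  rw [← (Ω.pullback_inChart_eventuallyEq hf x).extDeriv_eq] at e1
  have hψd : MDifferentiableAt I 𝓘(ℝ, E) (extChartAt I x) x :=
    mdifferentiableAt_extChartAt (mem_chart_source H x)
  have hχd : MDifferentiableAt I' 𝓘(ℝ, E') (extChartAt I' (f x)) (f x) :=
    mdifferentiableAt_extChartAt (mem_chart_source H' (f x))
  have e2 : (extChartAt I' (f x) ∘ f ∘ (extChartAt I x).symm) ∘ extChartAt I x =ᶠ[𝓝 x]
      extChartAt I' (f x) ∘ f := by
    filter_upwards [extChartAt_source_mem_nhds (I := I) x] with z hz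
    simp only [Function.comp_apply, (extChartAt I x).left_inv hz]
  have e3 := e2.mfderiv_eq (I := I) (I' := 𝓘(ℝ, E'))
  rw [mfderiv_comp x (hF.mdifferentiableAt (by simp)) hψd,
    mfderiv_comp x hχd (hf.mdifferentiable (by simp) x), mfderiv_eq_fderiv] at e3
  rw [hFx] at e1
  unfold DForm.d
  rw [e1]
  ext w
  exact congrArg (fun A : E →L[ℝ] E' => extDeriv (Ω.inChart (f x)) (extChartAt I' (f x) (f x))
    (fun i => A (w i))) e3

end Pullback

section Polar

/-- The orthogonal factor of the polar decomposition of an injective skew-adjoint operator. -/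
theorem exists_complexStructure_of_skew {V : Type*} [NormedAddCommGroup V] [InnerProductSpace ℝ V]
    [FiniteDimensional ℝ V] (A : V →ₗ[ℝ] V) (hA : ∀ u v, inner ℝ (A u) v = -inner ℝ u (A v))
    (hinj : Function.Injective A) :
    ∃ J : V →ₗ[ℝ] V, (∀ u, J (J u) = -u) ∧ (∀ u, J (A u) = A (J u)) ∧
      (∀ u v, inner ℝ (J u) (J v) = inner ℝ u v) ∧ ∀ u, u ≠ 0 → 0 < inner ℝ (A u) (J u) := by
  have hP : (-(A ∘ₗ A)).IsSymmetric := by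
    intro u v
    simp [hA]
  let b := hP.eigenvectorBasis rfl
  have hext : ∀ u v, (∀ i, inner ℝ (b i) u = inner ℝ (b i) v) → u = v := fun u v h => by
    rw [← b.sum_repr' u, ← b.sum_repr' v]
    simp only [h]
  let l := hP.eigenvalues rfl
  have hb : ∀ i, -A (A (b i)) = l i • b i := fun i => by
    simpa using hP.apply_eigenvectorBasis rfl i
  have hl : ∀ i, 0 < l i := by
    intro i
    have h1 : inner ℝ (-A (A (b i))) (b i) = l i := by
      rw [hb, inner_smul_left, real_inner_self_eq_norm_sq, b.norm_eq_one]; simp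
    rw [← h1, inner_neg_left, hA, neg_neg, real_inner_self_eq_norm_sq]
    have h2 : A (b i) ≠ 0 := by
      rw [Ne, map_eq_zero_iff A hinj]
      exact b.orthonormal.ne_zero i
    positivity
  let s : _ → ℝ := fun i => (Real.sqrt (l i))⁻¹
  have hs : ∀ i, 0 < s i := fun i => inv_pos.2 (Real.sqrt_pos.2 (hl i))
  let T : V →ₗ[ℝ] V := b.toBasis.constr ℝ (fun i => s i • b i)
  have hT : ∀ i, T (b i) = s i • b i := fun i => by
    have := b.toBasis.constr_basis ℝ (fun i => s i • b i) i
    rwa [b.coe_toBasis] at this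
  have hTin : ∀ v i, inner ℝ (b i) (T v) = s i * inner ℝ (b i) v := by
    intro v i
    conv_lhs => rw [← b.sum_repr' v]
    simp only [map_sum, map_smul, hT, inner_sum, inner_smul_right, b.inner_eq_ite]
    simp [mul_comm]
  have hTsymm : ∀ u v, inner ℝ (T u) v = inner ℝ u (T v) := by
    intro u v
    rw [← b.sum_inner_mul_inner (T u) v, ← b.sum_inner_mul_inner u (T v)]
    refine Finset.sum_congr rfl fun i _ => ?_
    rw [hTin, real_inner_comm, hTin, real_inner_comm u]
    ring
  have hTpos : ∀ u, u ≠ 0 → 0 < inner ℝ (T u) u := by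
    intro u hu
    rw [← b.sum_inner_mul_inner]
    have h1 : ∀ i, inner ℝ (T u) (b i) * inner ℝ (b i) u = s i * (inner ℝ (b i) u) ^ 2 := by
      intro i
      rw [real_inner_comm, hTin]; ring
    simp only [h1]
    have hn : ∀ i ∈ Finset.univ, 0 ≤ s i * (inner ℝ (b i) u) ^ 2 := fun i _ =>
      mul_nonneg (hs i).le (sq_nonneg _)
    refine lt_of_le_of_ne (Finset.sum_nonneg hn) fun h => hu ?_
    have h2 := (Finset.sum_eq_zero_iff_of_nonneg hn).1 h.symm
    refine hext _ _ fun i => ?_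
    have h3 := h2 i (Finset.mem_univ i)
    have h4 := (mul_eq_zero.1 h3).resolve_left (hs i).ne'
    simpa using h4
  have hTA : ∀ u, T (A u) = A (T u) := by
    have : T ∘ₗ A = A ∘ₗ T := by
      refine b.toBasis.ext fun i => ?_
      simp only [LinearMap.comp_apply, OrthonormalBasis.coe_toBasis, hT, map_smul]
      refine hext _ _ fun j => ?_
      simp only [hTin, inner_smul_right]
      have h1 : l j * inner ℝ (b j) (A (b i)) = l i * inner ℝ (b j) (A (b i)) := by
        rw [← inner_smul_right (b j) (A (b i)) (l i), ← map_smul, ← hb, map_neg,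
          ← real_inner_smul_left, ← hb]
        simp [hA]
      by_cases h0 : inner ℝ (b j) (A (b i)) = 0
      · simp [h0]
      · have : l j = l i := mul_right_cancel₀ h0 h1
        simp only [s, this]
    exact fun u => LinearMap.congr_fun this u
  have hTT : ∀ u, A (A (T (T u))) = -u := by
    have : A ∘ₗ A ∘ₗ T ∘ₗ T = -LinearMap.id := by
      refine b.toBasis.ext fun i => ?_
      simp only [LinearMap.comp_apply, OrthonormalBasis.coe_toBasis, hT, map_smul]
      rw [← neg_neg (A (A (b i))), hb, smul_neg, smul_neg, smul_smul, smul_smul]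
      have : s i * s i * l i = 1 := by
        have h1 := Real.mul_self_sqrt (hl i).le
        have h2 := (Real.sqrt_pos.2 (hl i)).ne'
        simp only [s]
        field_simp
        rw [pow_two]
        exact h1.symm
      simp [this]
    exact fun u => LinearMap.congr_fun this u
  refine ⟨A ∘ₗ T, fun u => ?_, fun u => ?_, fun u v => ?_, fun u hu => ?_⟩
  · simp only [LinearMap.comp_apply, hTA, hTT]
  · simp only [LinearMap.comp_apply, hTA]
  · simp only [LinearMap.comp_apply]
    rw [← hTA u, hTsymm, hA, ← hTA, ← hTA, ← hTA, hTA, hTA, hTA, hTA, hTT, inner_neg_right, neg_neg]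
  · simp only [LinearMap.comp_apply]
    rw [← hTA, real_inner_comm]
    exact hTpos _ (fun h => hu ((map_eq_zero_iff A hinj).1 h))

/-- A symmetric endomorphism with respect to a positive definite bilinear form has a basis of
eigenvectors. -/
theorem exists_eigenbasis {V : Type*} [AddCommGroup V] [Module ℝ V] [FiniteDimensional ℝ V]
    (g : V →ₗ[ℝ] V →ₗ[ℝ] ℝ) (hsymm : ∀ u v, g u v = g v u) (hpos : ∀ u, u ≠ 0 → 0 < g u u)
    (S : V →ₗ[ℝ] V) (hS : ∀ u v, g (S u) v = g u (S v)) :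
    ∃ (b : Module.Basis (Fin (Module.finrank ℝ V)) ℝ V) (l : Fin (Module.finrank ℝ V) → ℝ),
      ∀ i, S (b i) = l i • b i := by
  let core : InnerProductSpace.Core ℝ V :=
    { inner := fun u v => g u v
      conj_inner_symm := fun u v => hsymm v u
      re_inner_nonneg := fun u => by
        by_cases hu : u = 0
        · simp [hu]
        · exact (hpos u hu).le
      add_left := fun u v w => by simp
      smul_left := fun u v r => by simp
      definite := fun u hu => by
        by_contra h
        exact (hpos u h).ne' hu }
  let _ : NormedAddCommGroup V := @InnerProductSpace.Core.toNormedAddCommGroup ℝ V _ _ _ core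
  let _ : InnerProductSpace ℝ V := InnerProductSpace.ofCore core.toCore
  have h : S.IsSymmetric := hS
  refine ⟨(h.eigenvectorBasis rfl).toBasis, h.eigenvalues rfl, fun i => ?_⟩
  simp

/-- Polar decomposition `A = J S` of the operator `A` relating a nondegenerate skew form `w` to a
scalar product `g`: the factor `J` is a complex structure compatible with `w`. -/
theorem exists_compatible_complexStructure {V : Type*} [AddCommGroup V] [Module ℝ V]
    [FiniteDimensional ℝ V] (g w : V →ₗ[ℝ] V →ₗ[ℝ] ℝ) (hsymm : ∀ u v, g u v = g v u)
    (hpos : ∀ u, u ≠ 0 → 0 < g u u) (hskew : ∀ u v, w u v = -w v u)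
    (hnd : ∀ u, (∀ v, w u v = 0) → u = 0) :
    ∃ A S J : V →ₗ[ℝ] V, (∀ u v, g (A u) v = w u v) ∧ (∀ u, S (S u) = -A (A u)) ∧
      (∀ u v, g (S u) v = g u (S v)) ∧ (∀ u, u ≠ 0 → 0 < g (S u) u) ∧ (∀ u, J (S u) = A u) ∧
      (∀ u, J (J u) = -u) ∧ (∀ u v, w (J u) (J v) = w u v) ∧ ∀ u, u ≠ 0 → 0 < w u (J u) := by
  have hginj : Function.Injective g := by
    rw [injective_iff_map_eq_zero]
    intro u hu
    by_contra h
    exact (hpos u h).ne' (by simp [hu])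
  let e : V ≃ₗ[ℝ] Module.Dual ℝ V :=
    LinearEquiv.ofInjectiveOfFinrankEq g hginj Subspace.dual_finrank_eq.symm
  let A : V →ₗ[ℝ] V := e.symm.toLinearMap ∘ₗ w
  have hA : ∀ u v, g (A u) v = w u v := fun u v => by
    have h1 : e (A u) = w u := e.apply_symm_apply (w u)
    exact LinearMap.congr_fun h1 v
  let core : InnerProductSpace.Core ℝ V :=
    { inner := fun u v => g u v
      conj_inner_symm := fun u v => hsymm v u
      re_inner_nonneg := fun u => by
        by_cases hu : u = 0
        · simp [hu]
        · exact (hpos u hu).le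
      add_left := fun u v w => by simp
      smul_left := fun u v r => by simp
      definite := fun u hu => by
        by_contra h
        exact (hpos u h).ne' hu }
  let _ : NormedAddCommGroup V := @InnerProductSpace.Core.toNormedAddCommGroup ℝ V _ _ _ core
  let _ : InnerProductSpace ℝ V := InnerProductSpace.ofCore core.toCore
  obtain ⟨J, h1, h2, h3, h4⟩ := exists_complexStructure_of_skew A
    (fun u v => by
      change g (A u) v = -g u (A v)
      rw [hA, hsymm, hA, hskew])
    (by
      rw [injective_iff_map_eq_zero]
      intro u hu
      exact hnd u fun v => by rw [← hA, hu]; simp)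
  replace h3 : ∀ u v, g (J u) (J v) = g u v := h3
  replace h4 : ∀ u, u ≠ 0 → 0 < g (A u) (J u) := h4
  have hw : ∀ u v, w (J u) (J v) = w u v := fun u v => by
    rw [← hA, ← hA, ← h2, h3]
  have hS : ∀ u v, g (-J (A u)) v = w u (J v) := fun u v => by
    rw [← h3, map_neg, h1, neg_neg, hA]
  refine ⟨A, -(J ∘ₗ A), J, hA, fun u => ?_, fun u v => ?_, fun u hu => ?_, fun u => ?_, h1, hw,
    fun u hu => ?_⟩
  · simp [← h2, h1]
  · simp only [LinearMap.neg_apply, LinearMap.comp_apply]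
    rw [hS, hsymm, hS, ← hw, h1, map_neg, hskew, neg_neg]
  · simp only [LinearMap.neg_apply, LinearMap.comp_apply]
    rw [hS, ← hA]
    exact h4 u hu
  · simp [h1]
  · rw [← hA]
    exact h4 u hu

theorem ContinuousAt.eventually_norm_sub_lt {X B : Type*} [TopologicalSpace X]
    [NormedAddCommGroup B] {g : X → B} {x₀ : X} (hg : ContinuousAt g x₀) {ε : ℝ} (hε : 0 < ε) :
    ∀ᶠ x in 𝓝 x₀, ‖g x - g x₀‖ < ε := by
  simpa only [dist_eq_norm] using Metric.continuousAt_iff'.1 hg ε hε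

theorem eventually_coercive {X E : Type*} [TopologicalSpace X] [NormedAddCommGroup E]
    [NormedSpace ℝ E] [FiniteDimensional ℝ E] {g : X → E →L[ℝ] E →L[ℝ] ℝ} {x₀ : X}
    (hg : ContinuousAt g x₀) (hpos : ∀ u, u ≠ 0 → 0 < g x₀ u u) :
    ∃ c > 0, ∀ᶠ x in 𝓝 x₀, ∀ u, c * ‖u‖ ^ 2 ≤ g x u u := by
  rcases subsingleton_or_nontrivial E with hE | hE
  · refine ⟨1, one_pos, Filter.Eventually.of_forall fun x u => ?_⟩
    rw [Subsingleton.elim u 0]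
    simp
  have hcont : Continuous fun u => g x₀ u u := by fun_prop
  obtain ⟨u₀, hu₀, hmin⟩ := (isCompact_sphere (0 : E) 1).exists_isMinOn
    (NormedSpace.sphere_nonempty.2 zero_le_one) hcont.continuousOn
  have hu₀n : u₀ ≠ 0 := ne_zero_of_mem_unit_sphere ⟨u₀, hu₀⟩
  set m := g x₀ u₀ u₀ with hm
  have hmpos : 0 < m := hpos u₀ hu₀n
  have hlow : ∀ u, m * ‖u‖ ^ 2 ≤ g x₀ u u := by
    intro u
    by_cases hu : u = 0
    · simp [hu]
    have hn : ‖u‖ ≠ 0 := norm_ne_zero_iff.2 hu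
    have h1 : ‖u‖⁻¹ • u ∈ Metric.sphere (0 : E) 1 := by
      simp [norm_smul, hn]
    have h2 : m ≤ g x₀ (‖u‖⁻¹ • u) (‖u‖⁻¹ • u) := hmin h1
    have h3 : g x₀ u u = ‖u‖ ^ 2 * g x₀ (‖u‖⁻¹ • u) (‖u‖⁻¹ • u) := by
      simp only [map_smul, smul_apply, smul_eq_mul]
      field_simp
    rw [h3, mul_comm]
    exact mul_le_mul_of_nonneg_left h2 (sq_nonneg _)
  refine ⟨m / 2, half_pos hmpos, ?_⟩
  have hlt := @ContinuousAt.eventually_norm_sub_lt X (E →L[ℝ] E →L[ℝ] ℝ) _ _ g x₀ hg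
  filter_upwards [hlt (half_pos hmpos)]
    with x hx u
  have h1 : ‖(g x - g x₀) u u‖ ≤ ‖g x - g x₀‖ * ‖u‖ * ‖u‖ := (g x - g x₀).le_opNorm₂ u u
  have h2 : (g x - g x₀) u u = g x u u - g x₀ u u := rfl
  rw [h2, Real.norm_eq_abs] at h1
  have h3 := (abs_le.1 h1).1
  have h4 := hlow u
  nlinarith [mul_le_mul_of_nonneg_right hx.le (sq_nonneg ‖u‖)]

/-- A positive square root `S` of a family of operators `P` is continuous where `P` is. -/
theorem continuousAt_of_comp_self_eq {X E : Type*} [TopologicalSpace X] [NormedAddCommGroup E]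
    [NormedSpace ℝ E] [FiniteDimensional ℝ E] {g : X → E →L[ℝ] E →L[ℝ] ℝ} {S P : X → E →L[ℝ] E}
    {x₀ : X} (hg : ContinuousAt g x₀) (hgpos : ∀ u, u ≠ 0 → 0 < g x₀ u u)
    (hgsymm : ∀ u v, g x₀ u v = g x₀ v u)
    (hS : ∀ u v, g x₀ (S x₀ u) v = g x₀ u (S x₀ v))
    (hSpos : ∀ᶠ x in 𝓝 x₀, ∀ u, u ≠ 0 → 0 < g x (S x u) u)
    (hP : ContinuousAt P x₀) (hSP : ∀ᶠ x in 𝓝 x₀, ∀ u, S x (S x u) = P x u) :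
    ContinuousAt S x₀ := by
  obtain ⟨c, hc, hcg⟩ := eventually_coercive hg hgpos
  obtain ⟨b, l, hb⟩ := exists_eigenbasis
    (LinearMap.mk₂ ℝ (fun u v => g x₀ u v) (by simp) (by simp) (by simp) (by simp))
    hgsymm hgpos (S x₀).toLinearMap hS
  replace hb : ∀ i, S x₀ (b i) = l i • b i := hb
  have hl : ∀ i, 0 < l i := by
    intro i
    have h1 := hSpos.self_of_nhds (b i) (b.ne_zero i)
    rw [hb, map_smul, smul_apply, smul_eq_mul] at h1
    exact pos_of_mul_pos_left h1 (hgpos _ (b.ne_zero i)).le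
  obtain ⟨C, hC, hop⟩ := b.exists_opNorm_le (F := E)
  let K : ℝ := ‖g x₀‖ + 1
  let R : ℝ := ∑ i, K * ‖b i‖ / (l i * c)
  have hR : ∀ i, K * ‖b i‖ / (l i * c) ≤ R := fun i =>
    Finset.single_le_sum (f := fun i => K * ‖b i‖ / (l i * c)) (fun j _ => by
      have := hl j
      positivity) (Finset.mem_univ i)
  have hK : ∀ᶠ x in 𝓝 x₀, ‖g x‖ < K := by
    have hlt := @ContinuousAt.eventually_norm_sub_lt X (E →L[ℝ] E →L[ℝ] ℝ) _ _ g x₀ hg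
    filter_upwards [hlt one_pos]
      with x hx
    linarith [norm_sub_norm_le (g x) (g x₀)]
  have hbound : ∀ᶠ x in 𝓝 x₀, ‖S x - S x₀‖ ≤ C * (R * ‖P x - P x₀‖) := by
    filter_upwards [hcg, hSpos, hSP, hK] with x hx1 hx2 hx3 hx4
    have hR0 : 0 ≤ R := Finset.sum_nonneg fun j _ => by
      have := hl j
      positivity
    refine hop (by positivity) fun i => ?_
    refine le_trans ?_ (mul_le_mul_of_nonneg_right (hR i) (norm_nonneg _))
    set d := (S x - S x₀) (b i) with hd
    have hd' : d = S x (b i) - l i • b i := by rw [hd, sub_apply, hb]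
    have hSd : (P x - P x₀) (b i) = S x d + l i • d := by
      rw [sub_apply, ← hx3, ← hSP.self_of_nhds, hb, map_smul, hb, hd', map_sub, map_smul, smul_sub]
      abel
    have h1 : l i * (c * ‖d‖ ^ 2) ≤ g x ((P x - P x₀) (b i)) d := by
      rw [hSd, map_add, map_smul, add_apply, smul_apply, smul_eq_mul]
      have h2 : 0 ≤ g x (S x d) d := by
        by_cases h : d = 0
        · simp [h]
        · exact (hx2 d h).le
      have h3 := mul_le_mul_of_nonneg_left (hx1 d) (hl i).le
      linarith
    have h4 : g x ((P x - P x₀) (b i)) d ≤ K * (‖P x - P x₀‖ * ‖b i‖) * ‖d‖ :=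
      (Real.le_norm_self _).trans (((g x).le_opNorm₂ _ _).trans (by
        gcongr
        exact (P x - P x₀).le_opNorm _))
    rcases (norm_nonneg d).eq_or_lt with h0 | h0
    · rw [← h0]
      have := hl i
      positivity
    have h5 : l i * c * ‖d‖ ≤ K * (‖P x - P x₀‖ * ‖b i‖) := by
      refine le_of_mul_le_mul_right ?_ h0
      linarith
    rw [div_mul_eq_mul_div, le_div_iff₀ (mul_pos (hl i) hc)]
    linarith
  rw [ContinuousAt, tendsto_iff_norm_sub_tendsto_zero]
  have hP0 : Filter.Tendsto (fun x => C * (R * ‖P x - P x₀‖)) (𝓝 x₀) (𝓝 0) := by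
    have := (tendsto_iff_norm_sub_tendsto_zero.1 hP).const_mul R |>.const_mul C
    simpa using this
  exact squeeze_zero' (Filter.Eventually.of_forall fun x => norm_nonneg _) hbound hP0

/-- A positive square root `S` of a smooth family of operators `P` is smooth. -/
theorem contMDiffAt_of_comp_self_eq {E₀ : Type*} [NormedAddCommGroup E₀] [NormedSpace ℝ E₀]
    {H : Type*} [TopologicalSpace H] {I : ModelWithCorners ℝ E₀ H}
    {X : Type*} [TopologicalSpace X] [ChartedSpace H X] {E : Type*} [NormedAddCommGroup E]
    [NormedSpace ℝ E] [FiniteDimensional ℝ E] {g : X → E →L[ℝ] E →L[ℝ] ℝ} {S P : X → E →L[ℝ] E}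
    {x₀ : X} (hg : ContinuousAt g x₀) (hgpos : ∀ u, u ≠ 0 → 0 < g x₀ u u)
    (hgsymm : ∀ u v, g x₀ u v = g x₀ v u)
    (hS : ∀ u v, g x₀ (S x₀ u) v = g x₀ u (S x₀ v))
    (hSpos : ∀ᶠ x in 𝓝 x₀, ∀ u, u ≠ 0 → 0 < g x (S x u) u)
    (hP : ContMDiffAt I 𝓘(ℝ, E →L[ℝ] E) ∞ P x₀)
    (hSP : ∀ᶠ x in 𝓝 x₀, ∀ u, S x (S x u) = P x u) :
    ContMDiffAt I 𝓘(ℝ, E →L[ℝ] E) ∞ S x₀ := by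
  have hScont := continuousAt_of_comp_self_eq hg hgpos hgsymm hS hSpos hP.continuousAt hSP
  let S₀ := S x₀
  let f : (E →L[ℝ] E) → (E →L[ℝ] E) := fun T => T * T
  let D : (E →L[ℝ] E) →L[ℝ] (E →L[ℝ] E) :=
    ContinuousLinearMap.mul ℝ (E →L[ℝ] E) S₀ + (ContinuousLinearMap.mul ℝ (E →L[ℝ] E)).flip S₀
  have hD : ∀ T, D T = S₀ * T + T * S₀ := fun T => rfl
  have hinj : Function.Injective D := by
    rw [injective_iff_map_eq_zero]
    intro T hT
    obtain ⟨b, l, hb⟩ := exists_eigenbasis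
      (LinearMap.mk₂ ℝ (fun u v => g x₀ u v) (by simp) (by simp) (by simp) (by simp))
      hgsymm hgpos (S x₀).toLinearMap hS
    replace hb : ∀ i, S₀ (b i) = l i • b i := hb
    have hT0 : T.toLinearMap = 0 := by
      refine b.ext fun i => ?_
      by_contra h
      change ¬ T (b i) = 0 at h
      have h1 : S₀ (T (b i)) + T (S₀ (b i)) = 0 := by
        have := congrArg (fun U : E →L[ℝ] E => U (b i)) (hD T ▸ hT)
        exact this
      rw [hb, map_smul] at h1
      have h2 := hSpos.self_of_nhds (T (b i)) h
      have h3 := hSpos.self_of_nhds (b i) (b.ne_zero i)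
      change 0 < g x₀ (S₀ (T (b i))) (T (b i)) at h2
      change 0 < g x₀ (S₀ (b i)) (b i) at h3
      rw [eq_neg_of_add_eq_zero_left h1, map_neg, map_smul, neg_apply, smul_apply,
        smul_eq_mul] at h2
      rw [hb, map_smul, smul_apply, smul_eq_mul] at h3
      have h4 := pos_of_mul_pos_left h3 (hgpos _ (b.ne_zero i)).le
      have h5 := mul_pos h4 (hgpos _ h)
      linarith
    ext u
    exact LinearMap.congr_fun hT0 u
  let e : (E →L[ℝ] E) ≃L[ℝ] (E →L[ℝ] E) :=
    (LinearEquiv.ofInjectiveEndo D.toLinearMap hinj).toContinuousLinearEquiv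
  have hfd : ContDiffAt ℝ ∞ f S₀ := contDiffAt_id.mul contDiffAt_id
  have hf' : HasFDerivAt f (e : (E →L[ℝ] E) →L[ℝ] (E →L[ℝ] E)) S₀ := by
    have h1 := (hasFDerivAt_id (𝕜 := ℝ) S₀).mul' (hasFDerivAt_id S₀)
    refine h1.congr_fderiv ?_
    ext T : 1
    rfl
  have hst := hfd.hasStrictFDerivAt' hf' (by simp)
  have hinv : ContDiffAt ℝ ∞ (hst.localInverse f e S₀) (f S₀) := hfd.to_localInverse hf' (by simp)
  have hPx : P x₀ = f S₀ := by
    ext u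
    exact (hSP.self_of_nhds u).symm
  rw [← hPx] at hinv
  refine (hinv.contMDiffAt.comp x₀ hP).congr_of_eventuallyEq ?_
  filter_upwards [hScont.eventually hst.eventually_left_inverse, hSP] with x hx hx'
  have h1 : P x = f (S x) := by
    ext u
    exact (hx' u).symm
  rw [Function.comp_apply, h1]
  exact hx.symm

/-- The complex structure given by the polar decomposition of a smooth family of skew forms is
smooth. -/
theorem contMDiffAt_complexStructure {E₀ : Type*} [NormedAddCommGroup E₀] [NormedSpace ℝ E₀]
    {H : Type*} [TopologicalSpace H] {I : ModelWithCorners ℝ E₀ H}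
    {X : Type*} [TopologicalSpace X] [ChartedSpace H X] {E : Type*} [NormedAddCommGroup E]
    [NormedSpace ℝ E] [FiniteDimensional ℝ E] {g w : X → E →L[ℝ] E →L[ℝ] ℝ}
    {A S J : X → E →L[ℝ] E} {x₀ : X}
    (hg : ContMDiffAt I 𝓘(ℝ, E →L[ℝ] E →L[ℝ] ℝ) ∞ g x₀)
    (hw : ContMDiffAt I 𝓘(ℝ, E →L[ℝ] E →L[ℝ] ℝ) ∞ w x₀)
    (hgpos : ∀ᶠ x in 𝓝 x₀, ∀ u, u ≠ 0 → 0 < g x u u)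
    (hgsymm : ∀ u v, g x₀ u v = g x₀ v u)
    (hA : ∀ᶠ x in 𝓝 x₀, ∀ u v, g x (A x u) v = w x u v)
    (hSA : ∀ᶠ x in 𝓝 x₀, ∀ u, S x (S x u) = -A x (A x u))
    (hS : ∀ u v, g x₀ (S x₀ u) v = g x₀ u (S x₀ v))
    (hSpos : ∀ᶠ x in 𝓝 x₀, ∀ u, u ≠ 0 → 0 < g x (S x u) u)
    (hJ : ∀ᶠ x in 𝓝 x₀, ∀ u, J x (S x u) = A x u) :
    ContMDiffAt I 𝓘(ℝ, E →L[ℝ] E) ∞ J x₀ := by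
  have hginj : ∀ᶠ x in 𝓝 x₀, Function.Injective (g x) := by
    filter_upwards [hgpos] with x hx
    rw [injective_iff_map_eq_zero]
    intro u hu
    by_contra h
    exact (hx u h).ne' (by simp [hu])
  have hdim : Module.finrank ℝ E = Module.finrank ℝ (E →L[ℝ] ℝ) :=
    (Subspace.dual_finrank_eq (K := ℝ) (V := E)).symm.trans
      (LinearMap.toContinuousLinearMap (𝕜 := ℝ) (E := E) (F' := ℝ)).finrank_eq
  have hginv : ∀ᶠ x in 𝓝 x₀, (g x).IsInvertible := by
    filter_upwards [hginj] with x hx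
    exact ⟨(LinearEquiv.ofInjectiveOfFinrankEq (g x).toLinearMap hx hdim).toContinuousLinearEquiv,
      by ext u v; rfl⟩
  have hSinv : ∀ᶠ x in 𝓝 x₀, (S x).IsInvertible := by
    filter_upwards [hSpos] with x hx
    have hinj : Function.Injective (S x) := by
      rw [injective_iff_map_eq_zero]
      intro u hu
      by_contra h
      exact (hx u h).ne' (by simp [hu])
    exact ⟨(LinearEquiv.ofInjectiveEndo (S x).toLinearMap hinj).toContinuousLinearEquiv,
      by ext u; rfl⟩
  have hAs : ContMDiffAt I 𝓘(ℝ, E →L[ℝ] E) ∞ A x₀ := by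
    have h1 : ContDiffAt ℝ ∞ ContinuousLinearMap.inverse (g x₀) :=
      hginv.self_of_nhds.contDiffAt_map_inverse
    have h2 := (h1.contMDiffAt.comp x₀ hg).clm_comp hw
    refine h2.congr_of_eventuallyEq ?_
    filter_upwards [hginv, hA] with x hx hx'
    ext u
    have h3 : g x (A x u) = w x u := by
      ext v
      exact hx' u v
    simp only [Function.comp_apply, ContinuousLinearMap.comp_apply, ← h3]
    exact (hx.inverse_apply_eq.2 rfl).symm
  have hP : ContMDiffAt I 𝓘(ℝ, E →L[ℝ] E) ∞ (fun x => -(A x).comp (A x)) x₀ :=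
    (hAs.clm_comp hAs).neg
  have hSs := contMDiffAt_of_comp_self_eq hg.continuousAt hgpos.self_of_nhds hgsymm hS hSpos hP hSA
  have h1 : ContDiffAt ℝ ∞ ContinuousLinearMap.inverse (S x₀) :=
    hSinv.self_of_nhds.contDiffAt_map_inverse
  refine (hAs.clm_comp (h1.contMDiffAt.comp x₀ hSs)).congr_of_eventuallyEq ?_
  filter_upwards [hSinv, hJ] with x hx hx'
  obtain ⟨e, he⟩ := hx
  ext u
  simp only [Function.comp_apply, ContinuousLinearMap.comp_apply, ← hx', ← he,
    ContinuousLinearMap.inverse_equiv]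
  exact congrArg (J x) (e.apply_symm_apply u).symm

end Polar

section Compatible

theorem update_vec2_zero {α : Type*} (a b c : α) : Function.update ![a, b] 0 c = ![c, b] := by
  ext i
  fin_cases i <;> simp

theorem update_vec2_one {α : Type*} (a b c : α) : Function.update ![a, b] 1 c = ![a, c] := by
  ext i
  fin_cases i <;> simp

variable {E : Type*} [NormedAddCommGroup E] [NormedSpace ℝ E]
  {H : Type*} [TopologicalSpace H] {I : ModelWithCorners ℝ E H}
  {M : Type*} [TopologicalSpace M] [ChartedSpace H M]

instance (x : M) : T2Space (TangentSpace I x) :=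
  inferInstanceAs (T2Space E)

instance [FiniteDimensional ℝ E] (x : M) : FiniteDimensional ℝ (TangentSpace I x) :=
  inferInstanceAs (FiniteDimensional ℝ E)

/-- The bilinear form on the tangent space underlying a 2-form. -/
def DForm.toBilin (Ω : DForm I M 2) (x : M) : TangentSpace I x →ₗ[ℝ] TangentSpace I x →ₗ[ℝ] ℝ :=
  LinearMap.mk₂ ℝ (fun u v => Ω x ![u, v])
    (fun u u' v => by
      simpa [update_vec2_zero] using (Ω x).map_update_add ![u, v] 0 u u')
    (fun c u v => by
      simpa [update_vec2_zero] using (Ω x).map_update_smul ![u, v] 0 c u)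
    (fun u v v' => by
      simpa [update_vec2_one] using (Ω x).map_update_add ![u, v] 1 v v')
    (fun c u v => by
      simpa [update_vec2_one] using (Ω x).map_update_smul ![u, v] 1 c v)

@[simp]
theorem DForm.toBilin_apply (Ω : DForm I M 2) (x : M) (u v : TangentSpace I x) :
    Ω.toBilin x u v = Ω x ![u, v] := rfl

theorem DForm.skew (Ω : DForm I M 2) (x : M) (u v : TangentSpace I x) :
    Ω x ![u, v] = -Ω x ![v, u] := by
  have h := (Ω x).toAlternatingMap.map_swap ![v, u] (i := 0) (j := 1) (by simp)
  have h2 : ![v, u] ∘ Equiv.swap (0 : Fin 2) 1 = ![u, v] := by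
    ext i
    fin_cases i <;> simp
  rw [h2] at h
  exact h

variable [IsManifold I ∞ M]

theorem contMDiffAt_chartCoframe_chartFrame {x₀ y : M} (hy : y ∈ (chartAt H x₀).source) (u : E) :
    ContMDiffAt I 𝓘(ℝ, E) ∞ (fun x => chartCoframe (I := I) x₀ x (chartFrame (I := I) y x u)) y := by
  have h := (contMDiffAt_coordChangeL (IB := I) (n := ∞) (x := y)
    (e := trivializationAt E (TangentSpace I) y) (e' := trivializationAt E (TangentSpace I) x₀)
    (mem_chart_source H y) hy).clm_apply (contMDiffAt_const (c := u))
  refine h.congr_of_eventuallyEq ?_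
  filter_upwards [eventually_mem_chart_source (H := H) y, (chartAt H x₀).open_source.mem_nhds hy]
    with x hx hx'
  have hbase : x ∈ (trivializationAt E (TangentSpace I) y).baseSet ∩
      (trivializationAt E (TangentSpace I) x₀).baseSet := ⟨hx, hx'⟩
  rw [chartCoframe, chartFrame, Trivialization.symmL_apply _ hbase.1,
    Trivialization.continuousLinearMapAt_apply, Trivialization.linearMapAt_apply,
    if_pos hbase.2, ContinuousLinearEquiv.coe_coe,
    Trivialization.coordChangeL_apply _ _ hbase]

variable [FiniteDimensional ℝ E]

/-- The bilinear form `B(P u, P v)` on the model space. -/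
def pullbackBilin {x : M} (B : TangentSpace I x →ₗ[ℝ] TangentSpace I x →ₗ[ℝ] ℝ)
    (P : E →L[ℝ] TangentSpace I x) : E →L[ℝ] E →L[ℝ] ℝ :=
  (B.compl₁₂ P.toLinearMap P.toLinearMap).toContinuousBilinearMap

theorem DForm.IsSmooth.contMDiffAt_pullbackBilin [I.Boundaryless] {Ω : DForm I M 2}
    (hΩ : Ω.IsSmooth) (x₀ : M) :
    ContMDiffAt I 𝓘(ℝ, E →L[ℝ] E →L[ℝ] ℝ) ∞
      (fun x => pullbackBilin (Ω.toBilin x) (chartFrame x₀ x)) x₀ := by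
  refine contMDiffAt_clm_of_apply fun u => contMDiffAt_clm_of_apply fun v => ?_
  refine (hΩ.contMDiffAt_chartFrame x₀ ![u, v]).congr_of_eventuallyEq
    (Filter.Eventually.of_forall fun x => ?_)
  change Ω x ![chartFrame x₀ x u, chartFrame x₀ x v] = Ω x _
  congr 1
  ext i
  fin_cases i <;> rfl

set_option maxHeartbeats 2000000 in
set_option synthInstance.maxHeartbeats 400000 in
/-- Every manifold has a smooth Riemannian metric. -/
theorem exists_smooth_metric [I.Boundaryless] [T2Space M] [SecondCountableTopology M] :
    ∃ g : ∀ x : M, TangentSpace I x →L[ℝ] TangentSpace I x →L[ℝ] ℝ,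
      (∀ x u v, g x u v = g x v u) ∧ (∀ x u, u ≠ 0 → 0 < g x u u) ∧
      ContMDiff I (I.prod 𝓘(ℝ, E →L[ℝ] E →L[ℝ] ℝ)) ∞
        (fun b ↦ TotalSpace.mk' (E →L[ℝ] E →L[ℝ] ℝ)
          (E := fun x : M => TangentSpace I x →L[ℝ] TangentSpace I x →L[ℝ] ℝ) b (g b)) := by
  have : LocallyCompactSpace M := Manifold.locallyCompact_of_finiteDimensional I
  let t : ∀ x : M, Set (TangentSpace I x →L[ℝ] TangentSpace I x →L[ℝ] ℝ) := fun x =>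
    {B | (∀ u v, B u v = B v u) ∧ ∀ u, u ≠ 0 → 0 < B u u}
  have ht : ∀ x, Convex ℝ (t x) := by
    rintro x B ⟨hB1, hB2⟩ C ⟨hC1, hC2⟩ a b ha hb hab
    refine ⟨fun u v => ?_, fun u hu => ?_⟩
    · simp only [add_apply, smul_apply, hB1 u v, hC1 u v]
    · simp only [add_apply, smul_apply, smul_eq_mul]
      rcases ha.eq_or_lt with rfl | ha'
      · have : b = 1 := by linarith
        simpa [this] using hC2 u hu
      · exact add_pos_of_pos_of_nonneg (mul_pos ha' (hB2 u hu)) (mul_nonneg hb (hC2 u hu).le)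
  let e : E ≃L[ℝ] EuclideanSpace ℝ (Fin (Module.finrank ℝ E)) :=
    ContinuousLinearEquiv.ofFinrankEq (by simp)
  let B₁ : E →ₗ[ℝ] E →ₗ[ℝ] ℝ := (innerₗ _).compl₁₂ e.toLinearMap e.toLinearMap
  let B₀ : E →L[ℝ] E →L[ℝ] ℝ := B₁.toContinuousBilinearMap
  have hB₀ : ∀ u v, B₀ u v = inner ℝ (e u) (e v) := fun u v => rfl
  let s₀ : ∀ x₀ x : M, TangentSpace I x →L[ℝ] TangentSpace I x →L[ℝ] ℝ := fun x₀ x =>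
    (B₁.compl₁₂ (chartCoframe x₀ x).toLinearMap
      (chartCoframe x₀ x).toLinearMap).toContinuousBilinearMap
  have hs₀ : ∀ x₀ x u v, s₀ x₀ x u v = B₀ (chartCoframe x₀ x u) (chartCoframe x₀ x v) :=
    fun x₀ x u v => rfl
  obtain ⟨s, hs⟩ := exists_contMDiffSection_forall_mem_convex_of_local (n := ⊤) I
    (F_fiber := E →L[ℝ] E →L[ℝ] ℝ)
    (fun x : M => TangentSpace I x →L[ℝ] TangentSpace I x →L[ℝ] ℝ) t ht (by
      intro x₀
      refine ⟨(chartAt H x₀).source, chart_source_mem_nhds H x₀,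
        s₀ x₀, ?_, ?_⟩
      · intro y hy
        refine ContMDiffAt.contMDiffWithinAt ?_
        rw [contMDiffAt_bilin_iff_chartFrame]
        intro u v
        have h0 : ContMDiffAt I 𝓘(ℝ, E →L[ℝ] E →L[ℝ] ℝ) ∞ (fun _ : M => B₀) y := contMDiffAt_const
        exact (h0.clm_apply (contMDiffAt_chartCoframe_chartFrame (I := I) hy u)).clm_apply
          (contMDiffAt_chartCoframe_chartFrame (I := I) hy v)
      · intro y hy
        refine ⟨fun u v => ?_, fun u hu => ?_⟩
        · simp only [hs₀, hB₀]
          exact real_inner_comm _ _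
        · simp only [hs₀, hB₀]
          have h1 : chartCoframe (I := I) x₀ y u ≠ 0 := fun h => hu (by
            rw [← chartFrame_chartCoframe (I := I) hy u, h, map_zero])
          have h2 : e (chartCoframe x₀ y u) ≠ 0 := by simpa using h1
          rw [real_inner_self_eq_norm_sq]
          positivity)
  exact ⟨s, fun x => (hs x).1, fun x => (hs x).2, s.contMDiff⟩

/-- Every symplectic manifold has a compatible almost complex structure. -/
theorem IsSymplecticForm.exists_isCompatibleAlmostComplex [I.Boundaryless] [T2Space M]
    [SecondCountableTopology M] {Ω : DForm I M 2} (hΩ : IsSymplecticForm Ω) :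
    ∃ J : ∀ x : M, TangentSpace I x →L[ℝ] TangentSpace I x, IsCompatibleAlmostComplex Ω J := by
  obtain ⟨g, hsymm, hpos, hg⟩ := exists_smooth_metric (I := I) (M := M)
  let gl : ∀ x : M, TangentSpace I x →ₗ[ℝ] TangentSpace I x →ₗ[ℝ] ℝ := fun x =>
    LinearMap.mk₂ ℝ (fun u v => g x u v) (by simp) (by simp) (by simp) (by simp)
  have hpt := fun x : M => exists_compatible_complexStructure (gl x) (Ω.toBilin x)
    (hsymm x) (hpos x) (Ω.skew x) (hΩ.nondegenerate x)
  choose A S J hA hSA hS hSpos hJS hJJ hJw hJpos using hpt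
  simp only [gl, LinearMap.mk₂_apply, DForm.toBilin_apply] at hA hS hSpos hJw hJpos
  let toC : ∀ x : M, (TangentSpace I x →ₗ[ℝ] TangentSpace I x) →
      (TangentSpace I x →L[ℝ] TangentSpace I x) := fun x T =>
    LinearMap.toContinuousLinearMap T
  refine ⟨fun x => toC x (J x), ⟨?_, hJJ, hJw, hJpos⟩⟩
  rw [isSmoothEndo_iff_chartFrame]
  intro x₀
  let P := fun x => chartFrame (I := I) x₀ x
  let Q := fun x => chartCoframe (I := I) x₀ x
  have hPQ : ∀ᶠ x in 𝓝 x₀, (∀ u, P x (Q x u) = u) ∧ ∀ v, Q x (P x v) = v := by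
    filter_upwards [eventually_mem_chart_source (H := H) x₀] with x hx
    exact ⟨chartFrame_chartCoframe hx, chartCoframe_chartFrame hx⟩
  have hP0 : ∀ᶠ x in 𝓝 x₀, ∀ v, v ≠ 0 → P x v ≠ 0 := by
    filter_upwards [hPQ] with x hx v hv h
    exact hv (by rw [← hx.2 v, h, map_zero])
  refine contMDiffAt_complexStructure
    (g := fun x => pullbackBilin (gl x) (P x))
    (w := fun x => pullbackBilin (Ω.toBilin x) (P x))
    (A := fun x => (Q x).comp ((toC x (A x)).comp (P x)))
    (S := fun x => (Q x).comp ((toC x (S x)).comp (P x))) ?_ ?_ ?_ ?_ ?_ ?_ ?_ ?_ ?_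
  · exact contMDiffAt_clm_of_apply fun u => contMDiffAt_clm_of_apply fun v =>
      contMDiffAt_bilin_iff_chartFrame.1 (hg x₀) u v
  · exact hΩ.smooth.contMDiffAt_pullbackBilin x₀
  · filter_upwards [hP0] with x hx u hu
    exact hpos x _ (hx u hu)
  · exact fun u v => hsymm x₀ _ _
  · filter_upwards [hPQ] with x hx u v
    change g x (P x (Q x (A x (P x u)))) (P x v) = Ω x ![P x u, P x v]
    rw [hx.1, hA]
  · filter_upwards [hPQ] with x hx u
    change Q x (S x (P x (Q x (S x (P x u))))) = -Q x (A x (P x (Q x (A x (P x u)))))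
    rw [hx.1, hx.1, hSA, map_neg]
  · intro u v
    change g x₀ (P x₀ (Q x₀ (S x₀ (P x₀ u)))) (P x₀ v) =
      g x₀ (P x₀ u) (P x₀ (Q x₀ (S x₀ (P x₀ v))))
    rw [hPQ.self_of_nhds.1, hPQ.self_of_nhds.1, hS]
  · filter_upwards [hPQ, hP0] with x hx hx' u hu
    change 0 < g x (P x (Q x (S x (P x u)))) (P x u)
    rw [hx.1]
    exact hSpos x _ (hx' u hu)
  · filter_upwards [hPQ] with x hx u
    change Q x (J x (P x (Q x (S x (P x u))))) = Q x (A x (P x u))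
    rw [hx.1, hJS]

end Compatible

section TorusBundle

variable {E : Type*} [NormedAddCommGroup E] [NormedSpace ℝ E]
  {H : Type*} [TopologicalSpace H] {I : ModelWithCorners ℝ E H}
  {M : Type*} [TopologicalSpace M] [ChartedSpace H M]
  {E' : Type*} [NormedAddCommGroup E'] [NormedSpace ℝ E']
  {H' : Type*} [TopologicalSpace H'] {I' : ModelWithCorners ℝ E' H'}
  {N : Type*} [TopologicalSpace N] [ChartedSpace H' N]
  {k : ℕ} [MulAction (Torus k) M] {proj : M → N}

/-- The linear form on the tangent space underlying a 1-form. -/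
def DForm.toLin (Ω : DForm I M 1) (x : M) : TangentSpace I x →ₗ[ℝ] ℝ where
  toFun u := Ω x ![u]
  map_add' u v := by
    have h : ∀ w : TangentSpace I x, Function.update ![u] 0 w = ![w] := fun w => by
      ext i
      fin_cases i
      simp
    simpa [h] using (Ω x).map_update_add ![u] 0 u v
  map_smul' c u := by
    have h : ∀ w : TangentSpace I x, Function.update ![u] 0 w = ![w] := fun w => by
      ext i
      fin_cases i
      simp
    simpa [h] using (Ω x).map_update_smul ![u] 0 c u

@[simp]
theorem DForm.toLin_apply (Ω : DForm I M 1) (x : M) (u : TangentSpace I x) :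
    Ω.toLin x u = Ω x ![u] := rfl

namespace IsPrincipalTorusBundle

theorem proj_smul (h : IsPrincipalTorusBundle I I' k proj) (t : Torus k) (x : M) :
    proj (t • x) = proj x := by
  obtain ⟨e, hb, -, -, he⟩ := h.locally_trivial (proj x)
  have h1 := he t x (e.mem_source.2 hb)
  rw [← e.coe_fst h1.1, h1.2]

theorem mfderiv_proj_infinitesimalAction (h : IsPrincipalTorusBundle I I' k proj)
    (X : Fin k → ℝ) (x : M) : mfderiv I I' proj x (infinitesimalAction I X x) = 0 := by
  unfold infinitesimalAction
  set c : ℝ → M := fun s => torusExp (s • X) • x with hc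
  by_cases hd : MDifferentiableAt 𝓘(ℝ, ℝ) I c 0
  · have hc0 : c 0 = x := by
      have : torusExp (0 : Fin k → ℝ) = 1 := by
        funext i
        simp [torusExp]
      simp [hc, this]
    have h1 : MDifferentiableAt I I' proj (c 0) := h.smooth_proj.mdifferentiable (by simp) _
    have h2 : proj ∘ c = fun _ => proj x := funext fun s => h.proj_smul _ _
    have h3 := mfderiv_comp (0 : ℝ) h1 hd
    rw [h2, mfderiv_const] at h3
    have key : ∀ z (_ : z = x) (v : E),
        (mfderiv I I' proj z : E →L[ℝ] E') v = (mfderiv I I' proj x : E →L[ℝ] E') v := by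
      rintro _ rfl v
      rfl
    have h4 := congrArg (fun T : ℝ →L[ℝ] E' => T 1) h3
    exact (key _ hc0 _).symm.trans h4.symm
  · rw [mfderiv_zero_of_not_mdifferentiableAt hd]
    exact map_zero _

theorem exists_equiv_mfderiv_proj (h : IsPrincipalTorusBundle I I' k proj) (x : M) :
    ∃ T : E ≃ₗ[ℝ] E' × (Fin k → EuclideanSpace ℝ (Fin 1)),
      ∀ u : E, (mfderiv I I' proj x : E →L[ℝ] E') u = (T u).1 := by
  obtain ⟨e, hb, he, hes, -⟩ := h.locally_trivial (proj x)
  have hx : x ∈ e.source := e.mem_source.2 hb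
  have hex : e x ∈ e.target := e.map_source hx
  have hd : MDifferentiableAt I (I'.prod (torusModel k)) e x :=
    (he.contMDiffAt (e.open_source.mem_nhds hx)).mdifferentiableAt (by simp)
  have hds : MDifferentiableAt (I'.prod (torusModel k)) I e.toOpenPartialHomeomorph.symm (e x) :=
    (hes.contMDiffAt (e.open_target.mem_nhds hex)).mdifferentiableAt (by simp)
  have hxe : e.toOpenPartialHomeomorph.symm (e x) = x := e.toOpenPartialHomeomorph.left_inv hx
  have h1 : (e.toOpenPartialHomeomorph.symm ∘ e) =ᶠ[𝓝 x] id := by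
    filter_upwards [e.open_source.mem_nhds hx] with z hz
    exact e.toOpenPartialHomeomorph.left_inv hz
  have h2 : (e ∘ e.toOpenPartialHomeomorph.symm) =ᶠ[𝓝 (e x)] id := by
    filter_upwards [e.open_target.mem_nhds hex] with z hz
    exact e.toOpenPartialHomeomorph.right_inv hz
  have h3 := h1.mfderiv_eq (I := I) (I' := I)
  rw [mfderiv_comp x hds hd, mfderiv_id] at h3
  have h4 := h2.mfderiv_eq (I := I'.prod (torusModel k)) (I' := I'.prod (torusModel k))
  rw [mfderiv_comp (e x) (hxe.symm ▸ hd) hds, mfderiv_id, hxe] at h4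
  let A : E →L[ℝ] E' × (Fin k → EuclideanSpace ℝ (Fin 1)) :=
    mfderiv I (I'.prod (torusModel k)) e x
  let B : E' × (Fin k → EuclideanSpace ℝ (Fin 1)) →L[ℝ] E :=
    mfderiv (I'.prod (torusModel k)) I e.toOpenPartialHomeomorph.symm (e x)
  have hBA : B.comp A = ContinuousLinearMap.id ℝ E := h3
  have hAB : A.comp B = ContinuousLinearMap.id ℝ _ := h4
  refine ⟨LinearEquiv.ofLinearMap A.toLinearMap B.toLinearMap
    (LinearMap.ext fun u => congrArg (fun T : _ →L[ℝ] _ => T u) hAB)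
    (LinearMap.ext fun u => congrArg (fun T : _ →L[ℝ] _ => T u) hBA), fun u => ?_⟩
  have h5 : proj =ᶠ[𝓝 x] Prod.fst ∘ e := by
    filter_upwards [e.open_source.mem_nhds hx] with z hz
    exact (e.coe_fst hz).symm
  have h6 := h5.mfderiv_eq (I := I) (I' := I')
  rw [mfderiv_comp x mdifferentiableAt_fst hd, mfderiv_fst] at h6
  exact congrArg (fun T : E →L[ℝ] E' => T u) h6

variable [FiniteDimensional ℝ E] [FiniteDimensional ℝ E']

/-- The splitting of `T_x M` defined by a connection form: `u ↦ (dπ u, η u)`. -/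
theorem bijective_mfderiv_proj_prod (h : IsPrincipalTorusBundle I I' k proj)
    {η : Fin k → DForm I M 1} (hη : IsConnectionForm I η) (x : M) :
    Function.Bijective ((mfderiv I I' proj x).toLinearMap.prod
      (LinearMap.pi fun i => (η i).toLin x)) := by
  obtain ⟨T, hT⟩ := h.exists_equiv_mfderiv_proj x
  have hdim : Module.finrank ℝ (TangentSpace I x) =
      Module.finrank ℝ (TangentSpace I' (proj x) × (Fin k → ℝ)) := by
    refine T.finrank_eq.trans ?_
    rw [Module.finrank_prod, Module.finrank_prod]
    simp [Module.finrank_pi_fintype]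
    rfl
  have hsurj : Function.Surjective ((mfderiv I I' proj x).toLinearMap.prod
      (LinearMap.pi fun i => (η i).toLin x)) := by
    rintro ⟨v, c⟩
    let u₀ : TangentSpace I x := T.symm ((show E' from v), 0)
    have hu₀ : mfderiv I I' proj x u₀ = v :=
      (hT u₀).trans (congrArg Prod.fst (T.apply_symm_apply ((show E' from v), 0)))
    refine ⟨u₀ + infinitesimalAction I (fun i => c i - η i x ![u₀]) x, Prod.ext ?_ ?_⟩
    · simp [h.mfderiv_proj_infinitesimalAction, hu₀]
    · funext i
      change (η i).toLin x (u₀ + _) = c i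
      rw [map_add, DForm.toLin_apply, DForm.toLin_apply, hη.vertical]
      ring
  exact ⟨(LinearMap.injective_iff_surjective_of_finrank_eq_finrank hdim).2 hsurj, hsurj⟩

end IsPrincipalTorusBundle

end TorusBundle

section Lift

variable {E : Type*} [NormedAddCommGroup E] [NormedSpace ℝ E] [FiniteDimensional ℝ E]
  {H : Type*} [TopologicalSpace H] {I : ModelWithCorners ℝ E H}
  {M : Type*} [TopologicalSpace M] [ChartedSpace H M]
  {E' : Type*} [NormedAddCommGroup E'] [NormedSpace ℝ E'] [FiniteDimensional ℝ E']
  {H' : Type*} [TopologicalSpace H'] {I' : ModelWithCorners ℝ E' H'}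
  {N : Type*} [TopologicalSpace N] [ChartedSpace H' N]
  {k : ℕ} [MulAction (Torus k) M] {proj : M → N}

namespace IsPrincipalTorusBundle

/-- The splitting `T_x M ≃ T_{π x} N × ℝ^k` defined by a connection form. -/
def split (h : IsPrincipalTorusBundle I I' k proj) {η : Fin k → DForm I M 1}
    (hη : IsConnectionForm I η) (x : M) :
    TangentSpace I x ≃ₗ[ℝ] TangentSpace I' (proj x) × (Fin k → ℝ) :=
  LinearEquiv.ofBijective _ (h.bijective_mfderiv_proj_prod hη x)

variable (h : IsPrincipalTorusBundle I I' k proj) {η : Fin k → DForm I M 1}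
  (hη : IsConnectionForm I η)

theorem mfderiv_split_symm (x : M) (p : TangentSpace I' (proj x) × (Fin k → ℝ)) :
    mfderiv I I' proj x ((h.split hη x).symm p) = p.1 :=
  congrArg Prod.fst ((h.split hη x).apply_symm_apply p)

theorem form_split_symm (x : M) (p : TangentSpace I' (proj x) × (Fin k → ℝ)) (i : Fin k) :
    η i x ![(h.split hη x).symm p] = p.2 i :=
  congrFun (congrArg Prod.snd ((h.split hη x).apply_symm_apply p)) i

include h hη in
theorem tangent_ext {x : M} {u v : TangentSpace I x}
    (h1 : mfderiv I I' proj x u = mfderiv I I' proj x v) (h2 : ∀ i, η i x ![u] = η i x ![v]) :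
    u = v :=
  (h.split hη x).injective (Prod.ext h1 (funext h2))

variable [IsManifold I ∞ M] [IsManifold I' ∞ N]

/-- The splitting `T_x M ≃ T_{π x} N × ℝ^k` in the frames given by the charts at `x₀`, `π x₀`. -/
def splitInChart (x₀ x : M) : E →L[ℝ] E' × (Fin k → ℝ) :=
  LinearMap.toContinuousLinearMap
    (((chartCoframe (proj x₀) (proj x)).toLinearMap.prodMap LinearMap.id) ∘ₗ
      (h.split hη x).toLinearMap ∘ₗ (chartFrame x₀ x).toLinearMap)

theorem splitInChart_apply (x₀ x : M) (u : E) : h.splitInChart hη x₀ x u =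
    (chartCoframe (proj x₀) (proj x) (mfderiv I I' proj x (chartFrame x₀ x u)),
      fun i => η i x ![chartFrame x₀ x u]) := rfl

theorem contMDiffAt_splitInChart [I.Boundaryless] (x₀ : M) :
    ContMDiffAt I 𝓘(ℝ, E →L[ℝ] E' × (Fin k → ℝ)) ∞ (h.splitInChart hη x₀) x₀ := by
  refine contMDiffAt_clm_of_apply fun u => ?_
  simp only [splitInChart_apply]
  refine ContMDiffAt.prodMk_space
    ((contMDiffAt_mfderiv_chartFrame h.smooth_proj x₀).clm_apply contMDiffAt_const) ?_
  rw [contMDiffAt_pi_space]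
  intro i
  refine ((hη.smooth i).contMDiffAt_chartFrame x₀ ![u]).congr_of_eventuallyEq
    (Filter.Eventually.of_forall fun x => ?_)
  change η i x _ = η i x _
  congr 1
  ext j
  fin_cases j
  rfl

include h in
omit [FiniteDimensional ℝ E] [FiniteDimensional ℝ E'] [IsManifold I ∞ M]
  [IsManifold I' ∞ N] in
theorem eventually_mem_chart_source (x₀ : M) :
    ∀ᶠ x in 𝓝 x₀, x ∈ (chartAt H x₀).source ∧ proj x ∈ (chartAt H' (proj x₀)).source :=
  Filter.Eventually.and (chart_source_mem_nhds H x₀)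
    (h.smooth_proj.continuous.continuousAt.eventually (chart_source_mem_nhds H' (proj x₀)))

theorem eventually_isInvertible_splitInChart (x₀ : M) :
    ∀ᶠ x in 𝓝 x₀, (h.splitInChart hη x₀ x).IsInvertible := by
  filter_upwards [h.eventually_mem_chart_source x₀] with x hx
  have hdim : Module.finrank ℝ E = Module.finrank ℝ (E' × (Fin k → ℝ)) :=
    (h.split hη x).finrank_eq
  have hinj : Function.Injective (h.splitInChart hη x₀ x) := by
    rw [injective_iff_map_eq_zero]
    intro u hu
    rw [splitInChart_apply, Prod.mk_eq_zero] at hu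
    have h1 : mfderiv I I' proj x (chartFrame x₀ x u) = 0 := by
      rw [← chartFrame_chartCoframe (I := I') hx.2 (mfderiv I I' proj x (chartFrame x₀ x u)),
        hu.1, map_zero]
    have h2 : chartFrame (I := I) x₀ x u = 0 := by
      refine h.tangent_ext hη (by rw [h1, map_zero]) fun i => ?_
      rw [← DForm.toLin_apply, ← DForm.toLin_apply, map_zero]
      exact congrFun hu.2 i
    rw [← chartCoframe_chartFrame (I := I) hx.1 u, h2, map_zero]
  exact ⟨(LinearEquiv.ofInjectiveOfFinrankEq
    (h.splitInChart hη x₀ x).toLinearMap hinj hdim).toContinuousLinearEquiv, by ext u <;> rfl⟩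

theorem contMDiffAt_inverse_splitInChart [I.Boundaryless] (x₀ : M) :
    ContMDiffAt I 𝓘(ℝ, E' × (Fin k → ℝ) →L[ℝ] E) ∞
      (fun x => (h.splitInChart hη x₀ x).inverse) x₀ :=
  (h.eventually_isInvertible_splitInChart hη x₀).self_of_nhds.contDiffAt_map_inverse.contMDiffAt.comp
    x₀ (h.contMDiffAt_splitInChart hη x₀)

theorem eventually_chartCoframe_split_symm (x₀ : M) :
    ∀ᶠ x in 𝓝 x₀, ∀ p : TangentSpace I' (proj x) × (Fin k → ℝ),
      chartCoframe x₀ x ((h.split hη x).symm p) =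
        (h.splitInChart hη x₀ x).inverse (chartCoframe (proj x₀) (proj x) p.1, p.2) := by
  filter_upwards [h.eventually_mem_chart_source x₀,
    h.eventually_isInvertible_splitInChart hη x₀] with x hx hinv p
  refine (hinv.inverse_apply_eq.2 ?_).symm
  rw [splitInChart_apply, chartFrame_chartCoframe (I := I) hx.1, mfderiv_split_symm]
  simp only [form_split_symm]

/-- The vertical vector fields dual to the components of a connection form. -/
def verticalField (i : Fin k) (x : M) : TangentSpace I x :=
  (h.split hη x).symm (0, Pi.single i 1)

theorem isSmoothVectorField_verticalField [I.Boundaryless] (i : Fin k) :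
    IsSmoothVectorField (h.verticalField hη i) := by
  rw [isSmoothVectorField_iff_chartCoframe]
  intro x₀
  refine ((h.contMDiffAt_inverse_splitInChart hη x₀).clm_apply
    (contMDiffAt_const (c := ((0 : E'), Pi.single i 1)))).congr_of_eventuallyEq ?_
  filter_upwards [h.eventually_chartCoframe_split_symm hη x₀] with x hx
  rw [verticalField, hx, map_zero]

variable (J : ∀ y : N, TangentSpace I' y →L[ℝ] TangentSpace I' y)

/-- The horizontal lift `u ↦ π̃ J π_* u` of an endomorphism field on the base. -/
def liftEndo (x : M) : TangentSpace I x →L[ℝ] TangentSpace I x :=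
  LinearMap.toContinuousLinearMap ((h.split hη x).symm.toLinearMap ∘ₗ
    (LinearMap.inl ℝ (TangentSpace I' (proj x)) (Fin k → ℝ)) ∘ₗ (J (proj x)).toLinearMap ∘ₗ
      (mfderiv I I' proj x).toLinearMap)

omit [IsManifold I ∞ M] [IsManifold I' ∞ N] in
theorem liftEndo_apply (x : M) (u : TangentSpace I x) : h.liftEndo hη J x u =
    (h.split hη x).symm (J (proj x) (mfderiv I I' proj x u), 0) := rfl

omit [IsManifold I ∞ M] [IsManifold I' ∞ N] in
theorem mfderiv_liftEndo (x : M) (u : TangentSpace I x) :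
    mfderiv I I' proj x (h.liftEndo hη J x u) = J (proj x) (mfderiv I I' proj x u) := by
  rw [liftEndo_apply, mfderiv_split_symm]

omit [IsManifold I ∞ M] [IsManifold I' ∞ N] in
theorem form_liftEndo (x : M) (u : TangentSpace I x) (i : Fin k) :
    η i x ![h.liftEndo hη J x u] = 0 := by
  rw [liftEndo_apply, form_split_symm]
  rfl

variable {J}

include h in
omit [FiniteDimensional ℝ E] [FiniteDimensional ℝ E'] [IsManifold I ∞ M] in
/-- A smooth endomorphism field on the base, in the frames given by charts, along `π`. -/
theorem contMDiffAt_endo_comp_proj (hJ : IsSmoothEndo J) (x₀ : M) :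
    ContMDiffAt I 𝓘(ℝ, E' →L[ℝ] E') ∞ (fun x => (chartCoframe (proj x₀) (proj x)).comp
      ((J (proj x)).comp (chartFrame (proj x₀) (proj x)))) x₀ :=
  (isSmoothEndo_iff_chartFrame.1 hJ (proj x₀)).comp x₀ (h.smooth_proj x₀)

theorem isSmoothEndo_liftEndo [I.Boundaryless] (hJ : IsSmoothEndo J) :
    IsSmoothEndo (h.liftEndo hη J) := by
  rw [isSmoothEndo_iff_chartFrame]
  intro x₀
  have h1 := ((h.contMDiffAt_inverse_splitInChart hη x₀).clm_comp
    (contMDiffAt_const (c := ContinuousLinearMap.inl ℝ E' (Fin k → ℝ)))).clm_comp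
      ((h.contMDiffAt_endo_comp_proj hJ x₀).clm_comp
        (contMDiffAt_mfderiv_chartFrame h.smooth_proj x₀))
  refine h1.congr_of_eventuallyEq ?_
  filter_upwards [h.eventually_chartCoframe_split_symm hη x₀, h.eventually_mem_chart_source x₀]
    with x hx hx'
  ext u
  refine (hx (J (proj x) (mfderiv I I' proj x (chartFrame x₀ x u)), 0)).trans ?_
  change _ = (h.splitInChart hη x₀ x).inverse (chartCoframe (proj x₀) (proj x) (J (proj x)
    (chartFrame (proj x₀) (proj x) (chartCoframe (proj x₀) (proj x) _))), 0)
  rw [chartFrame_chartCoframe (I := I') hx'.2]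
  rfl

end IsPrincipalTorusBundle

end Lift

section AlmostSStructure

variable {E : Type*} [NormedAddCommGroup E] [NormedSpace ℝ E] [FiniteDimensional ℝ E]
  {H : Type*} [TopologicalSpace H] {I : ModelWithCorners ℝ E H}
  {M : Type*} [TopologicalSpace M] [ChartedSpace H M]
  {E' : Type*} [NormedAddCommGroup E'] [NormedSpace ℝ E'] [FiniteDimensional ℝ E']
  {H' : Type*} [TopologicalSpace H'] {I' : ModelWithCorners ℝ E' H'}
  {N : Type*} [TopologicalSpace N] [ChartedSpace H' N]
  {k : ℕ} [MulAction (Torus k) M] {proj : M → N}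

/-- A positive definite bilinear form on a finite-dimensional space has bounded unit ball. -/
theorem isVonNBounded_of_posDef {x : M} (g : TangentSpace I x →L[ℝ] TangentSpace I x →L[ℝ] ℝ)
    (hpos : ∀ u, u ≠ 0 → 0 < g u u) : Bornology.IsVonNBounded ℝ {v | g v v < 1} := by
  let g' : E →L[ℝ] E →L[ℝ] ℝ := g
  obtain ⟨c, hc, h⟩ := eventually_coercive (g := fun _ : ℝ => g') (x₀ := 0) continuousAt_const hpos
  replace h := h.self_of_nhds
  change Bornology.IsVonNBounded ℝ {v : E | g' v v < 1}
  refine NormedSpace.isVonNBounded_of_isBounded ℝ ?_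
  refine isBounded_iff_forall_norm_le.2 ⟨1 / c + 1, fun v hv => ?_⟩
  have h1 : c * ‖v‖ ^ 2 < 1 := (h v).trans_lt hv
  have h2 : ‖v‖ ^ 2 < 1 / c := by
    rw [lt_div_iff₀ hc]
    linarith
  nlinarith [sq_nonneg (‖v‖ - 1)]

variable {Ω : DForm I' N 2} {J : ∀ y : N, TangentSpace I' y →L[ℝ] TangentSpace I' y}

omit [FiniteDimensional ℝ E'] in
theorem IsCompatibleAlmostComplex.apply_symm [IsManifold I' ∞ N]
    (hJ : IsCompatibleAlmostComplex Ω J) (y : N)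
    (u v : TangentSpace I' y) : Ω y ![u, J y v] = Ω y ![v, J y u] := by
  rw [← hJ.invariant y u, hJ.sq, Ω.skew, ← Ω.toBilin_apply, map_neg, LinearMap.neg_apply, neg_neg,
    Ω.toBilin_apply]

variable (proj Ω J) in
/-- The bilinear form `π^*G + ∑ η^i ⊗ η^i`, where `G(u, v) = Ω(u, J v)`. -/
def liftMetric (η : Fin k → DForm I M 1) (x : M) :
    TangentSpace I x →L[ℝ] TangentSpace I x →L[ℝ] ℝ :=
  LinearMap.toContinuousBilinearMap
    ((Ω.toBilin (proj x)).compl₁₂ (mfderiv I I' proj x).toLinearMap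
        ((J (proj x)).toLinearMap ∘ₗ (mfderiv I I' proj x).toLinearMap) +
      ∑ i, (LinearMap.mul ℝ ℝ).compl₁₂ ((η i).toLin x) ((η i).toLin x))

omit [FiniteDimensional ℝ E'] [MulAction (Torus k) M] in
theorem liftMetric_apply (η : Fin k → DForm I M 1) (x : M) (u v : TangentSpace I x) :
    liftMetric proj Ω J η x u v =
      Ω (proj x) ![mfderiv I I' proj x u, J (proj x) (mfderiv I I' proj x v)] +
        ∑ i, η i x ![u] * η i x ![v] := by
  simp [liftMetric]

namespace IsPrincipalTorusBundle

variable [IsManifold I ∞ M] [IsManifold I' ∞ N] (h : IsPrincipalTorusBundle I I' k proj)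
  {η : Fin k → DForm I M 1} (hη : IsConnectionForm I η)

include h hη in
omit [IsManifold I ∞ M] in
theorem liftMetric_pos (hJ : IsCompatibleAlmostComplex Ω J) (x : M) (u : TangentSpace I x)
    (hu : u ≠ 0) : 0 < liftMetric proj Ω J η x u u := by
  rw [liftMetric_apply]
  have hsum : ∀ i ∈ Finset.univ, 0 ≤ η i x ![u] * η i x ![u] := fun i _ => mul_self_nonneg _
  by_cases h0 : mfderiv I I' proj x u = 0
  · rw [h0, ← Ω.toBilin_apply, map_zero, LinearMap.zero_apply, zero_add]
    refine lt_of_le_of_ne (Finset.sum_nonneg hsum) fun hs => hu ?_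
    have h1 := (Finset.sum_eq_zero_iff_of_nonneg hsum).1 hs.symm
    refine h.tangent_ext hη (by rw [h0, map_zero]) fun i => ?_
    rw [mul_self_eq_zero.1 (h1 i (Finset.mem_univ i)), ← DForm.toLin_apply, map_zero]
  · exact add_pos_of_pos_of_nonneg (hJ.pos _ _ h0) (Finset.sum_nonneg hsum)

include h hη in
theorem contMDiff_liftMetric [I.Boundaryless] [I'.Boundaryless] (hΩ : Ω.IsSmooth)
    (hJ : IsSmoothEndo J) :
    ContMDiff I (I.prod 𝓘(ℝ, E →L[ℝ] E →L[ℝ] ℝ)) ∞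
      (fun b ↦ TotalSpace.mk' (E →L[ℝ] E →L[ℝ] ℝ)
        (E := fun x : M => TangentSpace I x →L[ℝ] TangentSpace I x →L[ℝ] ℝ) b
        (liftMetric proj Ω J η b)) := by
  intro x₀
  rw [contMDiffAt_bilin_iff_chartFrame]
  intro u v
  have hD := fun w : E => (contMDiffAt_mfderiv_chartFrame h.smooth_proj x₀).clm_apply
    (contMDiffAt_const (c := w))
  have hW : ContMDiffAt I 𝓘(ℝ, E' →L[ℝ] E' →L[ℝ] ℝ) ∞
      (fun x => pullbackBilin (Ω.toBilin (proj x)) (chartFrame (proj x₀) (proj x))) x₀ :=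
    (hΩ.contMDiffAt_pullbackBilin (proj x₀)).comp x₀ (h.smooth_proj x₀)
  have hη' : ∀ (i : Fin k) (w : E), ContMDiffAt I 𝓘(ℝ, ℝ) ∞
      (fun x => η i x ![chartFrame x₀ x w]) x₀ := fun i w => by
    have h1 := (hη.smooth i).contMDiffAt_chartFrame x₀ ![w]
    refine h1.congr_of_eventuallyEq (Filter.Eventually.of_forall fun x => ?_)
    change η i x _ = η i x _
    congr 1
    ext j
    fin_cases j
    rfl
  have h1 := (hW.clm_apply (hD u)).clm_apply
    ((h.contMDiffAt_endo_comp_proj hJ x₀).clm_apply (hD v))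
  have h2 := contMDiffAt_finsetSum (t := Finset.univ) fun i (_ : i ∈ Finset.univ) =>
    (hη' i u).mul (hη' i v)
  refine (h1.add h2).congr_of_eventuallyEq ?_
  filter_upwards [h.eventually_mem_chart_source x₀] with x hx
  rw [liftMetric_apply]
  have hPQ : ∀ w, chartFrame (proj x₀) (proj x) (chartCoframe (proj x₀) (proj x) w) = w :=
    chartFrame_chartCoframe (I := I') hx.2
  simp only [Pi.add_apply, ContinuousLinearMap.comp_apply]
  congr 1
  change _ = Ω (proj x) ![chartFrame (proj x₀) (proj x) (chartCoframe (proj x₀) (proj x) _),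
    chartFrame (proj x₀) (proj x) (chartCoframe (proj x₀) (proj x) _)]
  rw [hPQ, hPQ, hPQ]

omit [IsManifold I ∞ M] [IsManifold I' ∞ N] in
theorem form_verticalField (i j : Fin k) (x : M) :
    η i x ![h.verticalField hη j x] = if i = j then 1 else 0 := by
  rw [verticalField, form_split_symm]
  exact Pi.single_apply _ _ _

/-- The metric `f·pk`-structure on a principal torus bundle determined by a connection form and a
compatible almost complex structure on the base. -/
def metricFPKStructure [I.Boundaryless] [I'.Boundaryless] (hΩ : Ω.IsSmooth)
    (hJ : IsCompatibleAlmostComplex Ω J) : MetricFPKStructure I M k where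
  φ := h.liftEndo hη J
  ξ := h.verticalField hη
  η := η
  g :=
    { inner := liftMetric proj Ω J η
      symm := fun x u v => by
        rw [liftMetric_apply, liftMetric_apply, hJ.apply_symm]
        simp only [mul_comm]
      pos := h.liftMetric_pos hη hJ
      isVonNBounded := fun x => isVonNBounded_of_posDef _ (h.liftMetric_pos hη hJ x)
      contMDiff := h.contMDiff_liftMetric hη hΩ hJ.smooth }
  smooth_φ := h.isSmoothEndo_liftEndo hη hJ.smooth
  smooth_ξ := h.isSmoothVectorField_verticalField hη
  smooth_η := hη.smooth
  f_structure := fun x u => by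
    rw [← eq_neg_iff_add_eq_zero]
    refine h.tangent_ext hη ?_ fun i => ?_
    · rw [map_neg]
      simp only [mfderiv_liftEndo, hJ.sq, map_neg]
    · rw [← DForm.toLin_apply, ← DForm.toLin_apply, map_neg]
      simp [form_liftEndo]
  η_ξ := h.form_verticalField hη
  φ_ξ := fun i x => by
    rw [liftEndo_apply, verticalField, mfderiv_split_symm, map_zero]
    exact map_zero _
  η_φ := fun i x u => h.form_liftEndo hη J x u i
  φ_sq := fun x u => by
    refine h.tangent_ext hη ?_ fun i => ?_
    · simp [mfderiv_liftEndo, hJ.sq, verticalField, mfderiv_split_symm]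
    · rw [form_liftEndo, ← DForm.toLin_apply]
      simp only [map_add, map_neg, map_sum, map_smul]
      simp [h.form_verticalField hη]
  compatible := fun x u v => by
    change liftMetric proj Ω J η x u v = liftMetric proj Ω J η x _ _ + _
    simp only [liftMetric_apply, mfderiv_liftEndo, form_liftEndo, hJ.invariant, zero_mul,
      Finset.sum_const_zero, add_zero]

theorem fundamentalForm_metricFPKStructure [I.Boundaryless] [I'.Boundaryless] (hΩ : Ω.IsSmooth)
    (hJ : IsCompatibleAlmostComplex Ω J) :
    (h.metricFPKStructure hη hΩ hJ).fundamentalForm = Ω.pullback proj := by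
  funext x
  ext w
  change liftMetric proj Ω J η x (h.liftEndo hη J x (w 0)) (w 1) =
    Ω (proj x) (fun i => mfderiv I I' proj x (w i))
  simp only [liftMetric_apply, mfderiv_liftEndo, form_liftEndo, hJ.invariant, zero_mul,
    Finset.sum_const_zero, add_zero]
  congr 1
  ext i
  fin_cases i <;> rfl

end IsPrincipalTorusBundle

end AlmostSStructure

end

theorem theorem4p2
    {E : Type*} [NormedAddCommGroup E] [NormedSpace ℝ E] [FiniteDimensional ℝ E]
    {H : Type*} [TopologicalSpace H] {I : ModelWithCorners ℝ E H} [I.Boundaryless]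
    {M : Type*} [TopologicalSpace M] [ChartedSpace H M] [IsManifold I ∞ M]
    [T2Space M] [SecondCountableTopology M]
    {E' : Type*} [NormedAddCommGroup E'] [NormedSpace ℝ E'] [FiniteDimensional ℝ E']
    {H' : Type*} [TopologicalSpace H'] {I' : ModelWithCorners ℝ E' H'} [I'.Boundaryless]
    {N : Type*} [TopologicalSpace N] [ChartedSpace H' N] [IsManifold I' ∞ N]
    [T2Space N] [SecondCountableTopology N]
    {k : ℕ} [MulAction (Torus k) M] (proj : M → N) (hproj : IsPrincipalTorusBundle I I' k proj)
    (Ω : DForm I' N 2) (hΩ : IsSymplecticForm Ω)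
    (η : Fin k → DForm I M 1) (hη : IsConnectionForm I η)
    (α : Fin k → ℝ) (hα : ∀ i, (η i).d = -(α i) • Ω.pullback proj) :
    (∃ J : ∀ y : N, TangentSpace I' y →L[ℝ] TangentSpace I' y, IsCompatibleAlmostComplex Ω J) ∧
    ∀ J : ∀ y : N, TangentSpace I' y →L[ℝ] TangentSpace I' y, IsCompatibleAlmostComplex Ω J →
      ∃ S : MetricFPKStructure I M k, S.IsAlmostS ∧
        S.η = η ∧
        (∀ i x, mfderiv I I' proj x (S.ξ i x) = 0) ∧
        (∀ (x : M) (u : TangentSpace I x),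
          IsHorizontalLift proj η x (J (proj x) (mfderiv I I' proj x u)) (S.φ x u)) ∧
        (∀ (x : M) (u v : TangentSpace I x), S.g.inner x u v =
          Ω (proj x) ![mfderiv I I' proj x u, J (proj x) (mfderiv I I' proj x v)] +
            ∑ i, η i x ![u] * η i x ![v]) ∧
        S.fundamentalForm = Ω.pullback proj ∧
        ∀ i, (S.η i).d = -(α i) • S.fundamentalForm := by
  refine ⟨hΩ.exists_isCompatibleAlmostComplex, fun J hJ => ?_⟩
  have hΦ := hproj.fundamentalForm_metricFPKStructure hη hΩ.smooth hJ
  have hα' : ∀ i, (η i).d = -(α i) • (hproj.metricFPKStructure hη hΩ.smooth hJ).fundamentalForm :=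
    fun i => by rw [hΦ, hα]
  refine ⟨hproj.metricFPKStructure hη hΩ.smooth hJ, ⟨?_, α, hα'⟩, rfl, fun i x => ?_,
    fun x u => ⟨?_, fun i => ?_⟩, fun x u v => ?_, hΦ, hα'⟩
  · rw [MetricFPKStructure.IsAlmostK, hΦ, hΩ.smooth.d_pullback hproj.smooth_proj, hΩ.closed]
    rfl
  · exact hproj.mfderiv_split_symm hη x _
  · exact hproj.mfderiv_liftEndo hη J x u
  · exact hproj.form_liftEndo hη J x u i
  · exact liftMetric_apply η x u v
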